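/- **Setting.** Let $X=\{t(x_0^3+x_1^3+x_2^3)=x_0x_1x_2\}\subset\mathbb P^2\times\mathbb C$. Put $m_0=(-1,-1)$, $m_1=(-1,2)$, $m_2=(2,-1)$ and $n_0=(-1,0)$, $n_1=(1,1)$, $n_2=(0,-1)$ in $\mathbb R^2$, with indices modulo $3$ and the pairing $\langle (p,q),(p',q')\rangle=pp'+qq'$; let $\Delta$, $\Delta^\vee$ be the triangles with vertices $m_k$, respectively $n_k$. *Valuations.* Let $n=(1-r)n_i+rn_{i+1}\in\partial\Delta^\vee$ with $0\le r\le1$. A (rational) homogeneous expression $s$ of degree $k$ in the $x_j$ with coefficients in $\mathbb C[t]$ is a section of $\mathcal O(k)$ on $X$; if $s/x_{i-1}^k=\sum_{p,q}c_{p,q}x^py^q$ is its (Laurent) expansion in $x=x_i/x_{i-1}$, $y=x_{i+1}/x_{i-1}$, in which $t=xy/(1+x^3+y^3)$, then $$\mathrm{val}_n(s)=\min\{(1-r)p+rq : c_{p,q}\neq0\}.$$ *Cost function.* Let $\pi:\mathbb R\to\partial\Delta^\vee$, $\pi(\theta)=(k+1-\theta)n_k+(\theta-k)n_{k+1}$ for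 $\theta\in[k,k+1)$, and $p:\mathbb R\to\partial\Delta$, $p(u)=(k+1-\frac u3)m_k+(\frac u3-k)m_{k+1}$ for $u\in[3k,3k+3)$ be the universal coverings. The affine $\mathbb R$-bundle $L$ on $\partial\Delta^\vee$ is trivial on the star $U_k$ of $n_k$, with transition function $n\mapsto-\langle m_{k+1}-m_k,n\rangle$ from $U_k$ to $U_{k+1}$, so that the functions $-\langle m_k,n\rangle$ on $U_k$ glue to a continuous convex section $\Phi_0$. Pull $L$ back along $\pi$ and write its sections in the (continued) trivialisation over $U_0$. The group $\Gamma=\pi_1(\partial\Delta^\vee,n_0)\cong\mathbb Z$ acts by monodromy on germs of affine sections at $n_0$; for the germ $s_u(\theta)=u\theta$ put $[u,\theta]=\sup_{\gamma\in\Gamma}(\gamma\cdot s_u)(\theta)$, $\Phi_0^\star(u)=\sup_{\theta\in\mathbb R}([u,\theta]-\Phi_0(\theta))$. The function $-[u,\theta]+\Phi_0(\theta)+\Phi_0^\star(u)$ is invariant under $\theta\mapsto\theta+3$ and $u\mapsto u+9$, and the cost function $c(n,m)$, $n\in\partial\Delta^\vee$, $m\in\partial\Delta$, is its value for any $\theta,u$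 with $\pi(\theta)=n$, $p(u)=m$. *The sections $S(a,b)$*, $a,b\ge0$, are defined by induction on $a+b$. Put $S(a,0)=x_1^a$, $S(0,b)=x_2^b$, $S(a,a)=(x_1x_2-tx_0^2)^a$. For $a>b\ge1$ put $$R_0(a,b)=x_1S(a-1,b)-t^2x_0S(a-2,b+1),$$ $$\Lambda_{a,b}=\Big\{(m,s)\in\mathbb Z^2 : m>0,\ s>0,\ \tfrac abm<a-s\le\tfrac{a-1}bm+1\Big\}.$$ This set is finite and its elements have distinct first coordinates; write it as $\{(\mu_1,s_1),\dots,(\mu_k,s_k)\}$ with $\mu_1<\dots<\mu_k$ and put $d_i=s_i-\mu_i$. For $i=1,\dots,k$ let $$R_i(a,b)=R_{i-1}(a,b)-\lambda_i\cdot\begin{cases}t^{2a+5\mu_i-2s_i}\,x_0^{a-d_i}\,S(2d_i-a,\,a+b-d_i)&\text{if }3d_i>2a,\\ t^{a+3\mu_i}\,x_0^{2a-3d_i}\,x_2^{3d_i+b-a}&\text{if }a-b\le3d_i\le2a,\\ t^{b+3s_i}\,x_0^{2b+3d_i}\,x_1^{a-b-3d_i}&\text{if }3d_i<a-b,\end{cases}$$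 where $\lambda_i$ is the coefficient of $x^{a+3\mu_i}y^{b+3s_i}$ in the expansion of $R_{i-1}(a,b)$ in $x=x_1/x_0$, $y=x_2/x_0$. Put $S(a,b)=R_k(a,b)$. For $b>a\ge1$ put $S(a,b)(x_0,x_1,x_2)=S(b,a)(x_0,x_2,x_1)$. (The exponent $2b+3d_i$ may be negative, e.g. for $(a,b)=(8,7)$; then $S(a,b)$ is a rational section, to which $\mathrm{val}_n$ applies all the same.) **Proposition.** For all integers $a>b\ge1$ and all $n\in\partial\Delta^\vee$, $$\mathrm{val}_n(S(a,b))=\frac{a+b}{3}\,c\Big(n,\ \frac a{a+b}m_0+\frac b{a+b}m_1\Big).$$ (At a vertex of $\Delta^\vee$ the equality holds for both ways of writing $n$ as $(1-r)n_i+rn_{i+1}$.) -/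

import Mathlib

/-! ### The two triangles and their boundaries -/

namespace FermatCubic

noncomputable section

/-- The standard pairing between `ℝ²` and its dual, in the dual bases `e₁, e₂` and `e₁ᵛ, e₂ᵛ`. -/
def pairing (m n : ℝ × ℝ) : ℝ := m.1 * n.1 + m.2 * n.2

/-- The vertices `m₀ = -e₁-e₂`, `m₁ = -e₁+2e₂`, `m₂ = 2e₁-e₂` of `Δ` (indices modulo 3). -/
def mVert : Fin 3 → ℝ × ℝ := ![(-1, -1), (-1, 2), (2, -1)]

/-- The vertices `n₀ = -e₁ᵛ`, `n₁ = e₁ᵛ+e₂ᵛ`, `n₂ = -e₂ᵛ` of `Δᵛ` (indices modulo 3). -/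
def nVert : Fin 3 → ℝ × ℝ := ![(-1, 0), (1, 1), (0, -1)]

/-- The residue modulo 3 of an integer, as an index of a vertex. -/
def res (k : ℤ) : Fin 3 := ((k : ZMod 3) : Fin 3)

/-- The affine map `ℝ → ℝ²` which sends `k` to `n_k` and `k + 1` to `n_{k+1}`; on `[k, k+1]` it
parametrises the edge `[n_k, n_{k+1}]`. -/
def nEdge (k : ℤ) (t : ℝ) : ℝ × ℝ :=
  ((k : ℝ) + 1 - t) • nVert (res k) + (t - k) • nVert (res (k + 1))

/-- The universal covering `π : ℝ → ∂Δᵛ`. -/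
def nCover (t : ℝ) : ℝ × ℝ := nEdge ⌊t⌋ t

/-- The universal covering `p : ℝ → ∂Δ`, which maps `[3k, 3(k+1))` onto `[m_k, m_{k+1})`. -/
def mCover (u : ℝ) : ℝ × ℝ :=
  ((⌊u / 3⌋ : ℝ) + 1 - u / 3) • mVert (res ⌊u / 3⌋) +
    (u / 3 - ⌊u / 3⌋) • mVert (res (⌊u / 3⌋ + 1))

/-! ### The affine `ℝ`-bundle `L` on `∂Δᵛ`, its dual, and the canonical cost function

Over the star `U_k` of the vertex `n_k` the bundle `L` is trivial, and the transition function from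
the trivialisation over `U_k` to the one over `U_{k+1}` is `n ↦ -⟨m_{k+1} - m_k, n⟩`.  Everything is
written on the universal cover `ℝ` of `∂Δᵛ`, where `(k-1, k+1)` lies over the star of `n_k`. -/

/-- The transition function of `L` from `U_k` to `U_{k+1}`, as an affine function of `t`. -/
def transition (k : ℤ) (t : ℝ) : ℝ :=
  -pairing (mVert (res (k + 1)) - mVert (res k)) (nEdge k t)

/-- The sum of the transition functions met on the way from `U_0` to `U_k` (with a minus sign when
one walks backwards). -/
def totalTransition (k : ℤ) (t : ℝ) : ℝ :=
  ∑ j ∈ Finset.Ico 0 k, transition j t - ∑ j ∈ Finset.Ico k 0, transition j t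

/-- The germ at `n₀` of the affine section `u t + b` of `L`, written in the trivialisation over
`U_0`, is continued to an affine section of the pullback of `L` to `ℝ`.  `deckAct j u b t` is the
value at `t`, in the trivialisation over `U_0`, of the germ which arises after going `j` times
around `∂Δᵛ`: the action of `j ∈ ℤ = π₁(∂Δᵛ, n₀)` on affine germs. -/
def deckAct (j : ℤ) (u b t : ℝ) : ℝ :=
  u * (t + 3 * j) + b + totalTransition (3 * j) (t + 3 * j)

/-- The canonical pairing `[s, t] = sup_γ (γ · s)(t)` of the affine germ `s = u t` with the point
`t`.  Here `u` is the coordinate (written `tᵛ` in the literature) on the universal cover of the dual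
affine manifold `∂Δ`. -/
def canonicalPairing (u t : ℝ) : ℝ := ⨆ j : ℤ, deckAct j u 0 t

/-- The continuous convex section `Φ₀` of `L` which over `U_k` is `n ↦ -⟨m_k, n⟩`, pulled back to
`ℝ` and written in the trivialisation over `U_0`. -/
def convexSection (t : ℝ) : ℝ :=
  -pairing (mVert (res ⌊t⌋)) (nCover t) - totalTransition ⌊t⌋ t

/-- The Legendre transform of `Φ₀`. -/
def legendre (u : ℝ) : ℝ := ⨆ t : ℝ, (canonicalPairing u t - convexSection t)

/-- The canonical cost function, on the universal covers. -/
def coverCost (u t : ℝ) : ℝ := -canonicalPairing u t + convexSection t + legendre u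

/-- The canonical cost function `c(n, m)` of `n ∈ ∂Δᵛ` and `m ∈ ∂Δ`: the function induced by
`coverCost` (see `cost_cover` for the independence of the chosen lifts). -/
def cost (n m : ℝ × ℝ) : ℝ :=
  coverCost (Function.invFun mCover m) (Function.invFun nCover n)

/-! ### The cost function does not depend on the lifts -/

lemma res_succ (k : ℤ) : res (k + 1) = res k + 1 := by
  unfold res
  push_cast
  rfl

lemma res_add_three (k : ℤ) : res (k + 3) = res k := by
  have h : k + 3 = k + 1 + 1 + 1 := by ring
  rw [h, res_succ, res_succ, res_succ]
  generalize res k = i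
  revert i
  decide

lemma transition_eq (k : ℤ) (t : ℝ) : transition k t = -3 * t + 3 * k := by
  unfold transition nEdge
  rw [res_succ]
  generalize res k = i
  fin_cases i <;> simp [pairing, mVert, nVert] <;> ring

lemma totalTransition_succ (k : ℤ) (t : ℝ) :
    totalTransition (k + 1) t = totalTransition k t + transition k t := by
  unfold totalTransition
  rcases le_or_gt 0 k with h | h
  · rw [Finset.Ico_eq_empty_of_le h, Finset.Ico_eq_empty_of_le (by omega : (0 : ℤ) ≤ k + 1)]
    have e : Finset.Ico 0 (k + 1) = insert k (Finset.Ico 0 k) := by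
      ext j
      simp only [Finset.mem_Ico, Finset.mem_insert]
      omega
    rw [e, Finset.sum_insert (by simp)]
    simp
    ring
  · rw [Finset.Ico_eq_empty_of_le h.le, Finset.Ico_eq_empty_of_le (by omega : k + 1 ≤ (0 : ℤ))]
    have e : Finset.Ico k 0 = insert k (Finset.Ico (k + 1) 0) := by
      ext j
      simp only [Finset.mem_Ico, Finset.mem_insert]
      omega
    rw [e, Finset.sum_insert (by simp)]
    simp

lemma totalTransition_eq (k : ℤ) (t : ℝ) :
    totalTransition k t = -3 * k * t + 3 * k * (k - 1) / 2 := by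
  induction k using Int.induction_on with
  | zero => simp [totalTransition]
  | succ k ih =>
    rw [totalTransition_succ, ih, transition_eq]
    push_cast
    ring
  | pred k ih =>
    have h := totalTransition_succ (-(k : ℤ) - 1) t
    rw [sub_add_cancel, ih, transition_eq] at h
    push_cast at h ⊢
    linarith

lemma deckAct_eq (j : ℤ) (u b t : ℝ) :
    deckAct j u b t = (u - 9 * j) * (t + 3 * j) + b + 9 * j * (3 * j - 1) / 2 := by
  rw [deckAct, totalTransition_eq]
  push_cast
  ring

lemma convexSection_eq (t : ℝ) :
    convexSection t = 3 * (⌊t⌋ + 1) * t - 1 - 3 * ⌊t⌋ * (⌊t⌋ + 1) / 2 := by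
  unfold convexSection nCover nEdge
  rw [totalTransition_eq, res_succ]
  generalize res ⌊t⌋ = i
  fin_cases i <;> simp [pairing, mVert, nVert, -Int.self_sub_floor] <;> ring

lemma deckAct_sub_le (j : ℤ) (u t : ℝ) :
    deckAct j u 0 t - convexSection t ≤ (u - 3 / 2) ^ 2 / 6 + 1 := by
  rw [deckAct_eq, convexSection_eq]
  have h1 := Int.floor_le t
  have h2 := Int.lt_floor_add_one t
  nlinarith [sq_nonneg (u - 9 * j - 3 / 2 - 3 * t), mul_nonneg (sub_nonneg.2 h1)
    (sub_nonneg.2 h2.le)]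

lemma bddAbove_deckAct (u t : ℝ) : BddAbove (Set.range fun j : ℤ => deckAct j u 0 t) := by
  refine ⟨(u - 3 / 2) ^ 2 / 6 + 1 + convexSection t, ?_⟩
  rintro _ ⟨j, rfl⟩
  have := deckAct_sub_le j u t
  simp only
  linarith

lemma bddAbove_legendre (u : ℝ) :
    BddAbove (Set.range fun t : ℝ => canonicalPairing u t - convexSection t) := by
  refine ⟨(u - 3 / 2) ^ 2 / 6 + 1, ?_⟩
  rintro _ ⟨t, rfl⟩
  have : canonicalPairing u t ≤ (u - 3 / 2) ^ 2 / 6 + 1 + convexSection t := by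
    refine ciSup_le fun j => ?_
    have := deckAct_sub_le j u t
    linarith
  simp only
  linarith

lemma canonicalPairing_add_three (u t : ℝ) :
    canonicalPairing u (t + 3) = canonicalPairing u t + (9 * t + 18) := by
  unfold canonicalPairing
  rw [ciSup_add (bddAbove_deckAct u t),
    ← (Equiv.addRight (1 : ℤ)).iSup_comp (g := fun j => deckAct j u 0 t + (9 * t + 18))]
  congr 1
  ext j
  rw [deckAct_eq, deckAct_eq, Equiv.coe_addRight]
  push_cast
  ring

lemma canonicalPairing_add_nine (u t : ℝ) :
    canonicalPairing (u + 9) t = canonicalPairing u t + (3 * u + 9) := by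
  unfold canonicalPairing
  rw [ciSup_add (bddAbove_deckAct u t), ← (Equiv.addRight (1 : ℤ)).iSup_comp]
  congr 1
  ext j
  rw [deckAct_eq, deckAct_eq, Equiv.coe_addRight]
  push_cast
  ring

lemma convexSection_add_three (t : ℝ) :
    convexSection (t + 3) = convexSection t + (9 * t + 18) := by
  rw [convexSection_eq, convexSection_eq]
  have : ⌊t + 3⌋ = ⌊t⌋ + 3 := by exact_mod_cast Int.floor_add_intCast t 3
  rw [this]
  push_cast
  ring

lemma legendre_add_nine (u : ℝ) : legendre (u + 9) = legendre u + (3 * u + 9) := by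
  unfold legendre
  rw [ciSup_add (bddAbove_legendre u)]
  congr 1
  ext t
  rw [canonicalPairing_add_nine]
  ring

lemma coverCost_add_three (u t : ℝ) : coverCost u (t + 3) = coverCost u t := by
  unfold coverCost
  rw [canonicalPairing_add_three, convexSection_add_three]
  ring

lemma coverCost_add_nine (u t : ℝ) : coverCost (u + 9) t = coverCost u t := by
  unfold coverCost
  rw [canonicalPairing_add_nine, legendre_add_nine]
  ring

lemma res_eq_res {j k : ℤ} (h : res j = res k) : ∃ l : ℤ, k = j + 3 * l := by
  have h' : ((j : ℤ) : ZMod 3) = ((k : ℤ) : ZMod 3) := h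
  rw [ZMod.intCast_eq_intCast_iff_dvd_sub] at h'
  obtain ⟨l, hl⟩ := h'
  exact ⟨l, by push_cast at hl; linarith⟩

lemma edge_unique (V : Fin 3 → ℝ × ℝ) (hV : V = nVert ∨ V = mVert) (i j : Fin 3) (f g : ℝ)
    (hf : 0 ≤ f) (hf' : f < 1) (hg : 0 ≤ g) (hg' : g < 1)
    (h : (1 - f) • V i + f • V (i + 1) = (1 - g) • V j + g • V (j + 1)) : i = j ∧ f = g := by
  rw [Prod.ext_iff] at h
  obtain ⟨h1, h2⟩ := h
  rcases hV with rfl | rfl <;> fin_cases i <;> fin_cases j <;>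
    simp [nVert, mVert] at h1 h2 ⊢ <;> linarith

lemma cover_unique (V : Fin 3 → ℝ × ℝ) (hV : V = nVert ∨ V = mVert) (t t' : ℝ)
    (h : ((⌊t⌋ : ℝ) + 1 - t) • V (res ⌊t⌋) + (t - ⌊t⌋) • V (res (⌊t⌋ + 1)) =
      ((⌊t'⌋ : ℝ) + 1 - t') • V (res ⌊t'⌋) + (t' - ⌊t'⌋) • V (res (⌊t'⌋ + 1))) :
    ∃ l : ℤ, t' = t + l * 3 := by
  have a1 := Int.floor_le t
  have a2 := Int.lt_floor_add_one t
  have b1 := Int.floor_le t'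
  have b2 := Int.lt_floor_add_one t'
  rw [res_succ, res_succ,
    show (⌊t⌋ : ℝ) + 1 - t = 1 - (t - ⌊t⌋) by ring,
    show (⌊t'⌋ : ℝ) + 1 - t' = 1 - (t' - ⌊t'⌋) by ring] at h
  obtain ⟨e1, e2⟩ := edge_unique V hV _ _ _ _ (by linarith) (by linarith) (by linarith)
    (by linarith) h
  obtain ⟨l, hl⟩ := res_eq_res e1
  refine ⟨l, ?_⟩
  have : (⌊t'⌋ : ℝ) = ⌊t⌋ + 3 * l := by exact_mod_cast hl
  linarith

/-- The cost function `c(n, m)` may be computed with arbitrary lifts `t` of `n` and `u` of `m`. -/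
theorem cost_cover (u t : ℝ) : cost (nCover t) (mCover u) = coverCost u t := by
  have hn : nCover (Function.invFun nCover (nCover t)) = nCover t :=
    Function.invFun_eq ⟨t, rfl⟩
  have hm : mCover (Function.invFun mCover (mCover u)) = mCover u :=
    Function.invFun_eq ⟨u, rfl⟩
  obtain ⟨k, hk⟩ := cover_unique nVert (Or.inl rfl) _ _ hn
  obtain ⟨l, hl⟩ := cover_unique mVert (Or.inr rfl) _ _ hm
  have p1 : ∀ u t : ℝ, coverCost u (t + k * 3) = coverCost u t := fun u t =>
    Function.Periodic.int_mul (f := coverCost u) (coverCost_add_three u) k t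
  have p2 : ∀ u t : ℝ, coverCost (u + l * 9) t = coverCost u t := fun u t =>
    Function.Periodic.int_mul (f := fun u => coverCost u t)
      (fun u => coverCost_add_nine u t) l u
  have hl' : u = Function.invFun mCover (mCover u) + l * 9 := by linarith
  unfold cost
  generalize Function.invFun nCover (nCover t) = t0 at *
  generalize Function.invFun mCover (mCover u) = u0 at *
  rw [hk, hl', p1, p2]

/-! ### Sections and their valuations -/

/-- Expressions in `x₀, x₁, x₂` and `t`: Laurent polynomials in `x₀, x₁, x₂` and polynomials in `t`,
with complex coefficients.  The basis element with index `(α, e)` is `t^e x₀^{α₀} x₁^{α₁} x₂^{α₂}`.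
A homogeneous expression of degree `k` in the `x_i` represents a (rational) section of `𝒪(k)` on
the family `t (x₀³ + x₁³ + x₂³) = x₀ x₁ x₂`. -/
abbrev Expr : Type := AddMonoidAlgebra ℂ ((Fin 3 → ℤ) × ℕ)

/-- The monomial `t^e x₀^i x₁^j x₂^k`. -/
def mono (e : ℕ) (i j k : ℤ) : Expr := AddMonoidAlgebra.single (![i, j, k], e) 1

/-- `x₀`. -/
def x0 : Expr := mono 0 1 0 0

/-- `x₁`. -/
def x1 : Expr := mono 0 0 1 0

/-- `x₂`. -/
def x2 : Expr := mono 0 0 0 1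

/-- The parameter `t`. -/
def tt : Expr := mono 1 0 0 0

/-- The involution of the exponents which interchanges `x₁` and `x₂`. -/
def swapExp : ((Fin 3 → ℤ) × ℕ) →+ ((Fin 3 → ℤ) × ℕ) where
  toFun p := (p.1 ∘ Equiv.swap 1 2, p.2)
  map_zero' := rfl
  map_add' _ _ := rfl

/-- The substitution `S(x₀, x₁, x₂) ↦ S(x₀, x₂, x₁)`. -/
def swap12 : Expr →ₐ[ℂ] Expr := AddMonoidAlgebra.mapDomainAlgHom ℂ ℂ swapExp

/-- Formal Laurent series in two variables `x, y` over `ℂ` (power series divided by monomials). -/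
abbrev Laurent : Type := HahnSeries (ℤ × ℤ) ℂ

/-- The inclusion of exponents `ℕ² → ℤ²`. -/
def expIncl : (Fin 2 →₀ ℕ) →+ ℤ × ℤ where
  toFun p := ((p 0 : ℤ), (p 1 : ℤ))
  map_zero' := by simp
  map_add' p q := by simp

lemma expIncl_injective : Function.Injective expIncl := by
  intro p q h
  simp only [expIncl, AddMonoidHom.coe_mk, ZeroHom.coe_mk, Prod.mk.injEq, Nat.cast_inj] at h
  ext i
  fin_cases i
  · exact h.1
  · exact h.2

lemma expIncl_le (p q : Fin 2 →₀ ℕ) : expIncl p ≤ expIncl q ↔ p ≤ q := by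
  simp [expIncl, Finsupp.le_def, Fin.forall_fin_two]

/-- The inclusion `ℂ⟦x, y⟧ → ` Laurent series. -/
def ofPower : MvPowerSeries (Fin 2) ℂ →+* Laurent :=
  (HahnSeries.embDomainRingHom expIncl expIncl_injective expIncl_le).comp
    (HahnSeries.toMvPowerSeries (σ := Fin 2) (R := ℂ)).symm.toRingHom

/-- The Taylor series of `t` in each of the three charts: `t = x y / (1 + x³ + y³)`. -/
def tSeries : MvPowerSeries (Fin 2) ℂ :=
  MvPowerSeries.X 0 * MvPowerSeries.X 1 *
    (1 + MvPowerSeries.X 0 ^ 3 + MvPowerSeries.X 1 ^ 3)⁻¹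

lemma tSeries_mul :
    tSeries * (1 + MvPowerSeries.X 0 ^ 3 + MvPowerSeries.X 1 ^ 3) =
      MvPowerSeries.X 0 * MvPowerSeries.X 1 := by
  rw [tSeries, mul_assoc, MvPowerSeries.inv_mul_cancel, mul_one]
  simp

/-- The expansion of the monomials at the point `x_i = x_{i+1} = 0` of the central fibre: in the
chart with coordinates `x = x_i / x_{i-1}`, `y = x_{i+1} / x_{i-1}` (so that `x_{i-1}` is set to `1`,
that is, sections of `𝒪(k)` are divided by `x_{i-1}^k`). -/
def monoExpand (i : Fin 3) : Multiplicative ((Fin 3 → ℤ) × ℕ) →* Laurent where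
  toFun p := HahnSeries.single (p.toAdd.1 i, p.toAdd.1 (i + 1)) 1 * ofPower tSeries ^ p.toAdd.2
  map_one' := by
    simp only [toAdd_one, Prod.fst_zero, Prod.snd_zero, Pi.zero_apply, pow_zero, mul_one]
    exact HahnSeries.single_zero_one
  map_mul' p q := by
    have h : (HahnSeries.single ((p * q).toAdd.1 i, (p * q).toAdd.1 (i + 1)) 1 : Laurent) =
        HahnSeries.single (p.toAdd.1 i, p.toAdd.1 (i + 1)) 1 *
          HahnSeries.single (q.toAdd.1 i, q.toAdd.1 (i + 1)) 1 := by
      rw [HahnSeries.single_mul_single]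
      simp
    rw [h, toAdd_mul, Prod.snd_add, pow_add]
    ring

/-- The Taylor (Laurent) expansion of a section in the `i`-th chart. -/
def expand (i : Fin 3) : Expr →ₐ[ℂ] Laurent :=
  AddMonoidAlgebra.lift ℂ Laurent ((Fin 3 → ℤ) × ℕ) (monoExpand i)

/-- The monomial valuation with weights `1 - r`, `r` of a Laurent series; it is `+∞` on `0`. -/
def weightVal (r : ℝ) (F : Laurent) : EReal :=
  ⨅ p ∈ F.support, (((1 - r) * p.1 + r * p.2 : ℝ) : EReal)

/-- The valuation `val_n(s)` at `n = (1-r) n_i + r n_{i+1}`, `0 ≤ r ≤ 1`. -/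
def val (i : Fin 3) (r : ℝ) (s : Expr) : EReal := weightVal r (expand i s)

/-! ### The inductive construction of the sections `S(a, b)` -/

/-- The set `Λ_{a,b}` of bad terms. -/
def badSet (a b : ℕ) : Set (ℕ × ℕ) :=
  {p | 0 < p.1 ∧ 0 < p.2 ∧ (a : ℚ) / b * p.1 < a - p.2 ∧
    (a : ℚ) - p.2 ≤ ((a : ℚ) - 1) / b * p.1 + 1}

open Classical in
/-- The elements `(m₁, s₁), (m₂, s₂), …` of `Λ_{a,b}`, listed so that `m₁ < m₂ < …`. -/
def badList (a b : ℕ) : List (ℕ × ℕ) :=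
  ((List.range b).product (List.range a)).filter (fun p => decide (p ∈ badSet a b))

lemma mem_badList {a b : ℕ} (hb : 0 < b) {p : ℕ × ℕ} : p ∈ badList a b ↔ p ∈ badSet a b := by
  obtain ⟨m, s⟩ := p
  simp only [badList, List.mem_filter, decide_eq_true_eq, and_iff_right_iff_imp]
  rintro ⟨hm, hs, h1, h2⟩
  simp only at hm hs h1 h2
  have hm' : (0 : ℚ) < m := by exact_mod_cast hm
  have hs' : (0 : ℚ) < s := by exact_mod_cast hs
  have ha0 : (0 : ℚ) ≤ a := by positivity
  have hnn : (0 : ℚ) ≤ (a : ℚ) / b * m := by positivity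
  have hsa : (s : ℚ) < a := by linarith
  have hb' : (0 : ℚ) < b := by exact_mod_cast hb
  have hmb : (m : ℚ) < b := by
    by_contra hcon
    have h3 : (b : ℚ) ≤ m := not_lt.1 hcon
    have h4 : (a : ℚ) ≤ (a : ℚ) / b * m := by
      rw [div_mul_eq_mul_div, le_div_iff₀ hb']
      exact mul_le_mul_of_nonneg_left h3 ha0
    linarith
  exact List.pair_mem_product.2
    ⟨List.mem_range.2 (by exact_mod_cast hmb), List.mem_range.2 (by exact_mod_cast hsa)⟩

lemma badList_sorted {a b : ℕ} (hb : 0 < b) :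
    (badList a b).Pairwise (fun p q => p.1 < q.1) := by
  have key : (badList a b).Pairwise (fun p q => p.1 < q.1 ∨ p.1 = q.1 ∧ p.2 < q.2) := by
    refine List.Pairwise.filter _ ?_
    unfold List.product
    rw [List.pairwise_flatMap]
    refine ⟨fun m _ => ?_, ?_⟩
    · rw [List.pairwise_map]
      exact List.pairwise_lt_range.imp (fun h => Or.inr ⟨rfl, h⟩)
    · refine List.pairwise_lt_range.imp ?_
      intro m m' h x hx y hy
      rw [List.mem_map] at hx hy
      obtain ⟨_, _, rfl⟩ := hx
      obtain ⟨_, _, rfl⟩ := hy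
      exact Or.inl h
  refine key.imp_of_mem ?_
  rintro ⟨m, s⟩ ⟨m', s'⟩ hp hq (h | ⟨h, h'⟩)
  · exact h
  · exfalso
    simp only at h h'
    subst h
    obtain ⟨hm, hs, h1, h2⟩ := (mem_badList hb).1 hp
    obtain ⟨-, hs', h3, h4⟩ := (mem_badList hb).1 hq
    simp only at h1 h2 h3 h4 hm
    have hb' : (0 : ℚ) < b := by exact_mod_cast hb
    have hm' : (0 : ℚ) < m := by exact_mod_cast hm
    have h5 : (s : ℚ) + 1 ≤ s' := by exact_mod_cast h'
    have h6 : ((a : ℚ) - 1) / b * m = (a : ℚ) / b * m - m / b := by ring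
    have h7 : (0 : ℚ) < m / b := by positivity
    linarith

/-- The step from `R_{i-1}(a,b)` to `R_i(a,b)` at the bad term `(m, s) = (m_i, s_i)`; `prev` stands
for the function `S` on the pairs already treated.  On `Λ_{a,b}` one has `s < a`, so that the
subtraction in the exponent of `t` is the honest one. -/
def correct (prev : ℕ → ℕ → Expr) (a b : ℕ) (R : Expr) (p : ℕ × ℕ) : Expr :=
  let m := p.1
  let s := p.2
  let d : ℤ := (s : ℤ) - m
  let coef : ℂ := (expand 1 R).coeff ((a : ℤ) + 3 * m, (b : ℤ) + 3 * s)
  if 2 * (a : ℤ) < 3 * d then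
    R - coef • (mono (2 * a + 5 * m - 2 * s) (a - d) 0 0 *
      prev (2 * d - a).toNat ((a : ℤ) + b - d).toNat)
  else if (a : ℤ) - b ≤ 3 * d then
    R - coef • mono (a + 3 * m) (2 * a - 3 * d) 0 (3 * d + b - a)
  else
    R - coef • mono (b + 3 * s) (2 * b + 3 * d) (a - b - 3 * d) 0

/-- `R_0(a,b) = x₁ S(a-1,b) - t² x₀ S(a-2,b+1)` for `a > b ≥ 1`. -/
def firstTerm (prev : ℕ → ℕ → Expr) (a b : ℕ) : Expr :=
  x1 * prev (a - 1) b - tt ^ 2 * x0 * prev (a - 2) (b + 1)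

/-- `R_k(a,b)`, where `k` is the number of bad terms, for `a > b ≥ 1`. -/
def lastTerm (prev : ℕ → ℕ → Expr) (a b : ℕ) : Expr :=
  (badList a b).foldl (correct prev a b) (firstTerm prev a b)

/-- The sections `S(a,b)`, by recursion on `a + b`.  (Only earlier sections are used by the
recursion, see `S_of_lt`, so that the value `0` in the definition is never met.) -/
def S (a b : ℕ) : Expr :=
  if b = 0 then x1 ^ a
  else if a = 0 then x2 ^ b
  else if a = b then (x1 * x2 - tt * x0 ^ 2) ^ a
  else if b < a then lastTerm (fun p q => if p + q < a + b then S p q else 0) a b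
  else swap12 (lastTerm (fun p q => if p + q < a + b then S p q else 0) b a)
termination_by a + b

lemma lastTerm_congr {a b : ℕ} (hb : 1 ≤ b) (hab : b < a) (f g : ℕ → ℕ → Expr)
    (h : ∀ p q, p + q < a + b → f p q = g p q) : lastTerm f a b = lastTerm g a b := by
  have h0 : firstTerm f a b = firstTerm g a b := by
    rw [firstTerm, firstTerm, h _ _ (by omega), h _ _ (by omega)]
  rw [lastTerm, lastTerm, h0]
  refine List.foldl_ext _ _ _ ?_
  rintro R ⟨m, s⟩ hp
  obtain ⟨hm, hs, h1, h2⟩ := (mem_badList (by omega)).1 hp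
  simp only at hm hs h1 h2
  have hnn : (0 : ℚ) ≤ (a : ℚ) / b * m := by positivity
  have hsa : s < a := by
    have : (s : ℚ) < a := by linarith
    exact_mod_cast this
  unfold correct
  dsimp only
  split_ifs with hc
  · rw [h _ _ (by omega)]
  · rfl
  · rfl

/-- For `a > b ≥ 1` one has `S(a,b) = R_k(a,b)`. -/
lemma S_of_lt {a b : ℕ} (hb : 1 ≤ b) (hab : b < a) : S a b = lastTerm S a b := by
  rw [S, if_neg (by omega), if_neg (by omega), if_neg (by omega), if_pos hab]
  exact lastTerm_congr hb hab _ _ (fun p q hpq => if_pos hpq)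

/-- For `b > a ≥ 1` one has `S(a,b,x₀,x₁,x₂) = S(b,a,x₀,x₂,x₁)`. -/
lemma S_of_gt {a b : ℕ} (ha : 1 ≤ a) (hab : a < b) : S a b = swap12 (S b a) := by
  rw [S_of_lt ha hab, S, if_neg (by omega), if_neg (by omega), if_neg (by omega),
    if_neg (by omega)]
  exact congrArg swap12
    (lastTerm_congr ha hab _ _ (fun p q hpq => if_pos (by omega)))

end

end FermatCubic

namespace FermatCubic

noncomputable section

/-! ### Supports of Laurent series -/

/-! Write W = 1/(1+x³+y³), so that t = xyW in each of the three charts, which are centred at the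
nodes of the central fibre. Every expansion that occurs is a monomial times a series in x³, y³. In
chart 0 the section S(a,b) is y^a, in chart 2 it is x^b, times a series with constant term 1, so
val_n is linear on these two edges. In chart 1, with exponents written (a+3m, b+3s), its terms
satisfy am + bs ≥ ab, and the endpoints (m,s) = (0,a) and (b,0) occur with coefficient 1; so val_n
is the minimum of two linear functions.

This is `newtonShape_S`, proved by induction on a+b. The recursion rests on 1 - W = (x³+y³)W
(`fermatInv_eq`): the terms of lowest x-degree in x₁S(a-1,b) and t²x₀S(a-2,b+1) are x^a y^(3a+b-3)
times W^(a-1) and W^a, and their difference is x^a y^(3a+b) W^a modulo higher powers of x. This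
moves the corner (0,a-1) up to (0,a). The induction must therefore carry the whole series on the two
unbounded edges, not only the corners.

The terms of R₀ still below the new segment are the bad ones. Each is cancelled by a section with
coefficient 1 there (`correction_mono`, `correction_section`), whose other terms are good or bad
with larger m, and which affects neither the unbounded edges nor the leading terms in the other
charts. Treating the bad terms in order of increasing m removes them all
(`NewtonShape.foldl_correct`).

On the other side, for 0 ≤ u < 3 the Legendre transform is 1 and [u,θ] = uθ on a window of length 3
in θ, so the cost is explicit and piecewise linear (`cost_eq`). The window ends over chart 1, which
produces the two branches of the minimum there. -/

lemma support_mul_subset_of {F G : Laurent} {A B C : Set (ℤ × ℤ)} (hF : F.support ⊆ A)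
    (hG : G.support ⊆ B) (h : ∀ p ∈ A, ∀ q ∈ B, p + q ∈ C) : (F * G).support ⊆ C := by
  intro z hz
  obtain ⟨p, hp, q, hq, rfl⟩ := HahnSeries.support_mul_subset hz
  exact h p (hF hp) q (hG hq)

lemma support_sub_subset_of {F G : Laurent} {A : Set (ℤ × ℤ)} (hF : F.support ⊆ A)
    (hG : G.support ⊆ A) : (F - G).support ⊆ A := by
  intro z hz
  by_contra hA
  apply hz
  have h1 : F.coeff z = 0 := by
    by_contra h
    exact hA (hF h)
  have h2 : G.coeff z = 0 := by
    by_contra h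
    exact hA (hG h)
  rw [HahnSeries.coeff_sub, h1, h2, sub_zero]

lemma support_smul_subset_of {F : Laurent} {A : Set (ℤ × ℤ)} (c : ℂ) (hF : F.support ⊆ A) :
    (c • F).support ⊆ A := by
  intro z hz
  refine hF fun h => hz ?_
  rw [HahnSeries.coeff_smul, h, smul_zero]

/-- The translate `p + 3ℕ²`. -/
def grid (p : ℤ × ℤ) : Set (ℤ × ℤ) := {z | ∃ k l : ℕ, z = (p.1 + 3 * k, p.2 + 3 * l)}

lemma self_mem_grid (p : ℤ × ℤ) : p ∈ grid p := ⟨0, 0, by simp⟩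

lemma grid_add {p q z w : ℤ × ℤ} (hz : z ∈ grid p) (hw : w ∈ grid q) : z + w ∈ grid (p + q) := by
  obtain ⟨k, l, rfl⟩ := hz
  obtain ⟨k', l', rfl⟩ := hw
  refine ⟨k + k', l + l', ?_⟩
  ext <;> simp <;> ring

lemma grid_trans {p q z : ℤ × ℤ} (hq : q ∈ grid p) (hz : z ∈ grid q) : z ∈ grid p := by
  obtain ⟨k, l, rfl⟩ := hq
  obtain ⟨k', l', rfl⟩ := hz
  refine ⟨k + k', l + l', ?_⟩
  ext <;> simp <;> ring

/-- `F` is the monomial with exponent `p` times a series in `x³, y³` with constant term `1`. -/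
structure Lead (p : ℤ × ℤ) (F : Laurent) : Prop where
  coeff_eq : F.coeff p = 1
  support_subset : F.support ⊆ grid p

lemma lead_single (p : ℤ × ℤ) : Lead p (HahnSeries.single p 1) := by
  refine ⟨by simp, fun z hz => ?_⟩
  rw [HahnSeries.support_single_of_ne one_ne_zero] at hz
  rw [Set.mem_singleton_iff.1 hz]
  exact self_mem_grid p

lemma Lead.mul {p q : ℤ × ℤ} {F G : Laurent} (hF : Lead p F) (hG : Lead q G) :
    Lead (p + q) (F * G) := by
  refine ⟨?_, support_mul_subset_of hF.2 hG.2 fun _ h _ h' => grid_add h h'⟩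
  rw [HahnSeries.coeff_mul, Finset.sum_eq_single (p, q), hF.1, hG.1, one_mul]
  · rintro ⟨z, w⟩ hzw hne
    exfalso
    rw [Finset.mem_antidiagonal] at hzw
    obtain ⟨hz, hw, he⟩ := hzw
    obtain ⟨k, l, rfl⟩ := hF.2 hz
    obtain ⟨k', l', rfl⟩ := hG.2 hw
    simp only [Prod.mk_add_mk, Prod.ext_iff, Prod.fst_add, Prod.snd_add] at he
    apply hne
    simp only [Prod.ext_iff]
    omega
  · intro h
    by_contra h0
    apply h
    rw [Finset.mem_antidiagonal]
    refine ⟨?_, ?_, rfl⟩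
    · simp [hF.1]
    · simp [hG.1]

lemma Lead.one : Lead 0 (1 : Laurent) := by
  rw [← HahnSeries.single_zero_one]
  exact lead_single 0

lemma Lead.pow {p : ℤ × ℤ} {F : Laurent} (hF : Lead p F) (n : ℕ) : Lead (n • p) (F ^ n) := by
  induction n with
  | zero => simpa using Lead.one
  | succ n ih =>
    rw [pow_succ, succ_nsmul]
    exact ih.mul hF

lemma Lead.sub {p : ℤ × ℤ} {F G : Laurent} (hF : Lead p F) (hG : G.support ⊆ grid p)
    (h0 : G.coeff p = 0) : Lead p (F - G) :=
  ⟨by rw [HahnSeries.coeff_sub, hF.1, h0, sub_zero], support_sub_subset_of hF.2 hG⟩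

/-- Subtracting a series whose support lies strictly above `p` does not change the leading term. -/
lemma Lead.sub_of_ne {p q : ℤ × ℤ} {F G : Laurent} (hF : Lead p F) (hG : G.support ⊆ grid q)
    (hq : q ∈ grid p) (hne : q ≠ p) : Lead p (F - G) := by
  refine hF.sub (fun z hz => grid_trans hq (hG hz)) ?_
  by_contra h
  obtain ⟨k, l, rfl⟩ := hq
  obtain ⟨k', l', h'⟩ := hG h
  apply hne
  simp only [Prod.ext_iff] at h' ⊢
  omega

/-- Every exponent of `F` takes a value `≥ c` under the linear form `ℓ`. -/
def OrdGE (ℓ : ℤ × ℤ →+ ℤ) (c : ℤ) (F : Laurent) : Prop := F.support ⊆ {z | c ≤ ℓ z}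

lemma OrdGE.mul {ℓ : ℤ × ℤ →+ ℤ} {c d : ℤ} {F G : Laurent} (hF : OrdGE ℓ c F) (hG : OrdGE ℓ d G) :
    OrdGE ℓ (c + d) (F * G) :=
  support_mul_subset_of hF hG fun p hp q hq => by
    simp only [Set.mem_ofPred_eq, map_add] at *
    omega

lemma OrdGE.sub {ℓ : ℤ × ℤ →+ ℤ} {c : ℤ} {F G : Laurent} (hF : OrdGE ℓ c F) (hG : OrdGE ℓ c G) :
    OrdGE ℓ c (F - G) := support_sub_subset_of hF hG

lemma OrdGE.smul {ℓ : ℤ × ℤ →+ ℤ} {c : ℤ} {F : Laurent} (k : ℂ) (hF : OrdGE ℓ c F) :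
    OrdGE ℓ c (k • F) := support_smul_subset_of k hF

lemma OrdGE.mono {ℓ : ℤ × ℤ →+ ℤ} {c d : ℤ} {F : Laurent} (hF : OrdGE ℓ c F) (h : d ≤ c) :
    OrdGE ℓ d F := fun _ hz => le_trans h (hF hz)

lemma OrdGE.zero (ℓ : ℤ × ℤ →+ ℤ) (c : ℤ) : OrdGE ℓ c 0 := by simp [OrdGE]

lemma OrdGE.coeff_eq_zero {ℓ : ℤ × ℤ →+ ℤ} {c : ℤ} {F : Laurent} (hF : OrdGE ℓ c F) {z : ℤ × ℤ}
    (hz : ℓ z < c) : F.coeff z = 0 := by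
  by_contra h
  exact absurd (hF h) (not_le.2 hz)

lemma ordGE_single (ℓ : ℤ × ℤ →+ ℤ) (p : ℤ × ℤ) (c : ℂ) : OrdGE ℓ (ℓ p) (HahnSeries.single p c) :=
  fun z hz => by
    rw [Set.mem_singleton_iff.1 (HahnSeries.support_single_subset hz)]
    exact le_refl (ℓ p)

/-- The first exponent. -/
abbrev expX : ℤ × ℤ →+ ℤ := AddMonoidHom.fst ℤ ℤ

/-- The second exponent. -/
abbrev expY : ℤ × ℤ →+ ℤ := AddMonoidHom.snd ℤ ℤ

lemma ordGE_expX_of_grid {p : ℤ × ℤ} {F : Laurent} (hF : F.support ⊆ grid p) : OrdGE expX p.1 F :=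
  fun z hz => by
    obtain ⟨k, l, rfl⟩ := hF hz
    simp

lemma ordGE_expY_of_grid {p : ℤ × ℤ} {F : Laurent} (hF : F.support ⊆ grid p) : OrdGE expY p.2 F :=
  fun z hz => by
    obtain ⟨k, l, rfl⟩ := hF hz
    simp

/-! ### The series `1 / (1 + x³ + y³)` -/

/-- The Laurent series of `1 + x³ + y³`. -/
def fermat : Laurent := 1 + HahnSeries.single (3, 0) 1 + HahnSeries.single (0, 3) 1

/-- The Laurent series of `1 / (1 + x³ + y³)`. -/
def fermatInv : Laurent := ofPower (1 + MvPowerSeries.X 0 ^ 3 + MvPowerSeries.X 1 ^ 3)⁻¹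

/-- The Laurent series of `t`. -/
def tLaurent : Laurent := ofPower tSeries

lemma ofPower_monomial (p : Fin 2 →₀ ℕ) (c : ℂ) :
    ofPower (MvPowerSeries.monomial p c) = HahnSeries.single (expIncl p) c := by
  have h : (HahnSeries.toMvPowerSeries (σ := Fin 2) (R := ℂ)).symm (MvPowerSeries.monomial p c) =
      HahnSeries.single p c := by
    classical
    ext n
    rw [HahnSeries.coeff_toMvPowerSeries_symm, MvPowerSeries.coeff_monomial]
    by_cases h : n = p
    · rw [h, if_pos rfl, HahnSeries.coeff_single_same]
    · rw [if_neg h, HahnSeries.coeff_single_of_ne h]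
  unfold ofPower
  rw [RingHom.comp_apply]
  change HahnSeries.embDomain _ ((HahnSeries.toMvPowerSeries (σ := Fin 2) (R := ℂ)).symm _) = _
  rw [h, HahnSeries.embDomain_single]
  rfl

lemma ofPower_X_zero : ofPower (MvPowerSeries.X 0) = HahnSeries.single (1, 0) 1 := by
  rw [MvPowerSeries.X, ofPower_monomial]
  simp [expIncl]

lemma ofPower_X_one : ofPower (MvPowerSeries.X 1) = HahnSeries.single (0, 1) 1 := by
  rw [MvPowerSeries.X, ofPower_monomial]
  simp [expIncl]

lemma ofPower_support (F : MvPowerSeries (Fin 2) ℂ) :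
    (ofPower F).support ⊆ {z | 0 ≤ z.1 ∧ 0 ≤ z.2} := by
  intro z hz
  obtain ⟨p, -, rfl⟩ := HahnSeries.support_embDomain_subset hz
  exact ⟨Int.natCast_nonneg _, Int.natCast_nonneg _⟩

lemma fermatInv_mul_fermat : fermatInv * fermat = 1 := by
  have h : ofPower ((1 + MvPowerSeries.X 0 ^ 3 + MvPowerSeries.X 1 ^ 3)⁻¹ *
      (1 + MvPowerSeries.X 0 ^ 3 + MvPowerSeries.X 1 ^ 3)) = 1 := by
    rw [MvPowerSeries.inv_mul_cancel _ (by simp), map_one]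
  rw [map_mul, map_add, map_add, map_pow, map_pow, map_one, ofPower_X_zero, ofPower_X_one,
    HahnSeries.single_pow, HahnSeries.single_pow] at h
  simpa [fermat, fermatInv] using h

lemma tLaurent_eq : tLaurent = HahnSeries.single (1, 1) 1 * fermatInv := by
  unfold tLaurent tSeries fermatInv
  rw [map_mul, map_mul, ofPower_X_zero, ofPower_X_one, HahnSeries.single_mul_single]
  simp

/-- Comparing coefficients in W(1+x³+y³) = 1 expresses the coefficient at (p,q) ≠ (0,0) through
those at (p-3,q) and (p,q-3). Induction on p+q then confines the support to 3ℕ². -/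
lemma lead_fermatInv : Lead 0 fermatInv := by
  have hrec : ∀ p q : ℤ, fermatInv.coeff (p, q) + fermatInv.coeff (p - 3, q) +
      fermatInv.coeff (p, q - 3) = if (p, q) = (0, 0) then 1 else 0 := by
    intro p q
    have h := congrArg (fun F : Laurent => F.coeff (p, q)) fermatInv_mul_fermat
    simp only [fermat, mul_add, mul_one, HahnSeries.coeff_add, HahnSeries.coeff_mul_single,
      Prod.mk_sub_mk, sub_zero, HahnSeries.coeff_one] at h
    rw [h]
    congr
  have hneg : ∀ p q : ℤ, p < 0 ∨ q < 0 → fermatInv.coeff (p, q) = 0 := by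
    intro p q h
    by_contra h0
    have := ofPower_support _ h0
    simp only [Set.mem_ofPred_eq] at this
    omega
  have hsupp : ∀ n : ℕ, ∀ p q : ℤ, p + q ≤ n → fermatInv.coeff (p, q) ≠ 0 →
      (p, q) ∈ grid (0, 0) := by
    intro n
    induction n using Nat.strong_induction_on with
    | _ n ih =>
      intro p q hpq h0
      by_cases hp : p < 0 ∨ q < 0
      · exact absurd (hneg p q hp) h0
      by_cases hz : (p, q) = (0, 0)
      · rw [hz]
        exact self_mem_grid _
      have h := hrec p q
      rw [if_neg hz] at h
      by_cases h1 : fermatInv.coeff (p - 3, q) = 0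
      · have h2 : fermatInv.coeff (p, q - 3) ≠ 0 := by
          intro h2
          rw [h1, h2] at h
          exact h0 (by simpa using h)
        have h3 : ¬ (p < 0 ∨ q - 3 < 0) := fun h3 => h2 (hneg _ _ h3)
        exact grid_trans (ih (p + (q - 3)).toNat (by omega) p (q - 3) (by omega) h2)
          ⟨0, 1, by simp⟩
      · have h3 : ¬ (p - 3 < 0 ∨ q < 0) := fun h3 => h1 (hneg _ _ h3)
        exact grid_trans (ih (p - 3 + q).toNat (by omega) (p - 3) q (by omega) h1)
          ⟨1, 0, by simp⟩
  refine ⟨?_, ?_⟩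
  · have h := hrec 0 0
    rw [hneg (0 - 3) 0 (by omega), hneg 0 (0 - 3) (by omega), if_pos rfl] at h
    rw [add_zero, add_zero] at h
    exact h
  · rintro ⟨p, q⟩ h
    exact hsupp (p + q).toNat p q (by omega) h

lemma lead_tLaurent : Lead (1, 1) tLaurent := by
  rw [tLaurent_eq]
  simpa using (lead_single (1, 1)).mul lead_fermatInv

lemma lead_fermatInv_pow (n : ℕ) : Lead 0 (fermatInv ^ n) := by
  simpa using lead_fermatInv.pow n

/-! ### Interchanging the two variables -/

/-- The interchange of the two exponents. -/
def flipExp : ℤ × ℤ →+ ℤ × ℤ := (AddEquiv.prodComm (M := ℤ) (N := ℤ)).toAddMonoidHom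

lemma flipExp_apply (z : ℤ × ℤ) : flipExp z = (z.2, z.1) := rfl

lemma flipExp_injective : Function.Injective flipExp := AddEquiv.prodComm.injective

lemma flipExp_le (z w : ℤ × ℤ) : flipExp z ≤ flipExp w ↔ z ≤ w := by
  simp [flipExp_apply, Prod.le_def, and_comm]

/-- The interchange of `x` and `y` in a Laurent series. -/
def flip : Laurent →+* Laurent :=
  HahnSeries.embDomainRingHom flipExp flipExp_injective (fun {z w} => flipExp_le z w)

lemma flip_coeff (F : Laurent) (z : ℤ × ℤ) : (flip F).coeff (z.2, z.1) = F.coeff z :=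
  HahnSeries.embDomain_coeff (f := ⟨⟨flipExp, flipExp_injective⟩, fun {z w} => flipExp_le z w⟩)

lemma flip_single (z : ℤ × ℤ) (c : ℂ) :
    flip (HahnSeries.single z c) = HahnSeries.single (z.2, z.1) c :=
  HahnSeries.embDomain_single

lemma mem_support_flip {F : Laurent} {z : ℤ × ℤ} :
    z ∈ (flip F).support ↔ (z.2, z.1) ∈ F.support := by
  rw [HahnSeries.mem_support, HahnSeries.mem_support, ← flip_coeff F]

lemma flip_fermat : flip fermat = fermat := by
  simp only [fermat, map_add, map_one, flip_single]
  ring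

lemma flip_fermatInv : flip fermatInv = fermatInv := by
  have h := congrArg flip fermatInv_mul_fermat
  rw [map_mul, flip_fermat, map_one] at h
  calc flip fermatInv = flip fermatInv * (fermatInv * fermat) := by
        rw [fermatInv_mul_fermat, mul_one]
    _ = flip fermatInv * fermat * fermatInv := by ring
    _ = fermatInv := by rw [h, one_mul]

lemma flip_tLaurent : flip tLaurent = tLaurent := by
  rw [tLaurent_eq, map_mul, flip_single, flip_fermatInv]

lemma Lead.flip {p : ℤ × ℤ} {F : Laurent} (hF : Lead p F) : Lead (p.2, p.1) (flip F) := by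
  refine ⟨by rw [flip_coeff, hF.1], fun z hz => ?_⟩
  obtain ⟨k, l, h⟩ := hF.2 (mem_support_flip.1 hz)
  simp only [Prod.ext_iff] at h
  exact ⟨l, k, Prod.ext h.2 h.1⟩

/-! ### Expansions of monomials -/

lemma expand_mono (n : Fin 3) (e : ℕ) (i j k : ℤ) :
    expand n (mono e i j k) =
      HahnSeries.single (![i, j, k] n, ![i, j, k] (n + 1)) 1 * tLaurent ^ e := by
  unfold expand mono
  rw [AddMonoidAlgebra.lift_single, one_smul]
  rfl

lemma lead_mono (n : Fin 3) (e : ℕ) (i j k : ℤ) :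
    Lead (![i, j, k] n + e, ![i, j, k] (n + 1) + e) (expand n (mono e i j k)) := by
  rw [expand_mono]
  simpa using (lead_single (![i, j, k] n, ![i, j, k] (n + 1))).mul (lead_tLaurent.pow e)

/-- The transposition reverses the cyclic order of the indices, so it matches two charts with x and
y exchanged, and t is symmetric in x and y. -/
lemma expand_swap12 (n n' : Fin 3) (h : Equiv.swap 1 2 n = n' + 1) (h' : Equiv.swap 1 2 (n + 1) = n')
    (s : Expr) : expand n (swap12 s) = flip (expand n' s) := by
  induction s using AddMonoidAlgebra.induction_linear with
  | zero => simp
  | add f g hf hg => rw [map_add, map_add, map_add, map_add, hf, hg]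
  | single p c =>
    have e1 : swap12 (AddMonoidAlgebra.single p c) = AddMonoidAlgebra.single (swapExp p) c :=
      AddMonoidAlgebra.mapDomain_single
    have e2 : ∀ F : Laurent, flip (c • F) = c • flip F := by
      intro F
      rw [← HahnSeries.C_mul_eq_smul, ← HahnSeries.C_mul_eq_smul, map_mul]
      congr 1
      exact flip_single 0 c
    rw [e1, expand, expand, AddMonoidAlgebra.lift_single, AddMonoidAlgebra.lift_single, e2]
    congr 1
    change HahnSeries.single (p.1 (Equiv.swap 1 2 n), p.1 (Equiv.swap 1 2 (n + 1))) 1 *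
      tLaurent ^ p.2 = flip (HahnSeries.single (p.1 n', p.1 (n' + 1)) 1 * tLaurent ^ p.2)
    rw [map_mul, map_pow, flip_tLaurent, flip_single, h, h']

lemma lead_mono_zero (e : ℕ) (i j k : ℤ) : Lead (i + e, j + e) (expand 0 (mono e i j k)) :=
  lead_mono 0 e i j k

lemma lead_mono_one (e : ℕ) (i j k : ℤ) : Lead (j + e, k + e) (expand 1 (mono e i j k)) :=
  lead_mono 1 e i j k

lemma lead_mono_two (e : ℕ) (i j k : ℤ) : Lead (k + e, i + e) (expand 2 (mono e i j k)) :=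
  lead_mono 2 e i j k

lemma mono_mul_mono (e e' : ℕ) (i j k i' j' k' : ℤ) :
    mono e i j k * mono e' i' j' k' = mono (e + e') (i + i') (j + j') (k + k') := by
  simp [mono, AddMonoidAlgebra.single_mul_single]

lemma mono_pow (e : ℕ) (i j k : ℤ) (n : ℕ) :
    mono e i j k ^ n = mono (n * e) (n * i) (n * j) (n * k) := by
  simp [mono, AddMonoidAlgebra.single_pow]

/-! ### Newton polygons of the sections -/

/-- The properties of the expansions of `S(a,b)`, up to unwanted terms `x^{a+3m} y^{b+3s}`,
`(m, s) ∈ A`, at the point `x₁ = x₂ = 0`: the shape of the Newton polygon, the terms on its two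
unbounded edges, and the leading terms in the other two charts. -/
structure NewtonShape (a b : ℕ) (A : Set (ℕ × ℕ)) (R : Expr) : Prop where
  polygon : ∀ z ∈ (expand 1 R).support, ∃ m s : ℕ, z = ((a : ℤ) + 3 * m, (b : ℤ) + 3 * s) ∧
    (a * b ≤ a * m + b * s ∨ (m, s) ∈ A)
  column : 0 < b → OrdGE expX (a + 1)
    (expand 1 R - HahnSeries.single ((a : ℤ), 3 * (a : ℤ) + b) 1 * fermatInv ^ a)
  row : 0 < a → OrdGE expY (b + 1)
    (expand 1 R - HahnSeries.single ((a : ℤ) + 3 * b, (b : ℤ)) 1 * fermatInv ^ b)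
  lead_zero : Lead (0, (a : ℤ)) (expand 0 R)
  lead_two : Lead ((b : ℤ), 0) (expand 2 R)

lemma expand_one_x1_pow (a : ℕ) : expand 1 (x1 ^ a) = HahnSeries.single ((a : ℤ), 0) 1 := by
  rw [x1, mono_pow, expand_mono]
  simp

/-- For b = 0 the polygon inequality is void and there is no term x^a y^(3a) when a > 0; this is why
`column` assumes 0 < b. -/
lemma newtonShape_x1_pow (a : ℕ) : NewtonShape a 0 ∅ (x1 ^ a) where
  polygon z hz := by
    rw [expand_one_x1_pow] at hz
    refine ⟨0, 0, ?_, by simp⟩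
    rw [Set.mem_singleton_iff.1 (HahnSeries.support_single_subset hz)]
    simp
  column h := absurd h (lt_irrefl 0)
  row _ := by
    rw [expand_one_x1_pow]
    simpa using OrdGE.zero _ _
  lead_zero := by
    rw [x1, mono_pow]
    simpa using lead_mono_zero (a * 0) (a * 0) (a * 1) (a * 0)
  lead_two := by
    rw [x1, mono_pow]
    simpa using lead_mono_two (a * 0) (a * 0) (a * 1) (a * 0)

lemma expand_zero_swap12 (s : Expr) : expand 0 (swap12 s) = flip (expand 2 s) :=
  expand_swap12 0 2 rfl rfl s

lemma expand_one_swap12 (s : Expr) : expand 1 (swap12 s) = flip (expand 1 s) :=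
  expand_swap12 1 1 rfl rfl s

lemma expand_two_swap12 (s : Expr) : expand 2 (swap12 s) = flip (expand 0 s) :=
  expand_swap12 2 0 rfl rfl s

lemma OrdGE.flip_expX {c : ℤ} {F : Laurent} (h : OrdGE expX c F) : OrdGE expY c (flip F) :=
  fun _ hz => h (mem_support_flip.1 hz)

lemma OrdGE.flip_expY {c : ℤ} {F : Laurent} (h : OrdGE expY c F) : OrdGE expX c (flip F) :=
  fun _ hz => h (mem_support_flip.1 hz)

lemma NewtonShape.swap {a b : ℕ} {R : Expr} (h : NewtonShape a b ∅ R) :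
    NewtonShape b a ∅ (swap12 R) where
  polygon z hz := by
    rw [expand_one_swap12, mem_support_flip] at hz
    obtain ⟨m, s, h1, h2⟩ := h.polygon _ hz
    simp only [Prod.ext_iff] at h1
    refine ⟨s, m, Prod.ext h1.2 h1.1, Or.inl ?_⟩
    simp only [Set.mem_empty_iff_false, or_false] at h2
    linarith
  column ha := by
    have := (h.row ha).flip_expY
    rwa [map_sub, map_mul, map_pow, flip_fermatInv, flip_single, ← expand_one_swap12,
      add_comm (a : ℤ)] at this
  row hb := by
    have := (h.column hb).flip_expX
    rwa [map_sub, map_mul, map_pow, flip_fermatInv, flip_single, ← expand_one_swap12,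
      add_comm (3 * (a : ℤ))] at this
  lead_zero := by
    rw [expand_zero_swap12]
    exact h.lead_two.flip
  lead_two := by
    rw [expand_two_swap12]
    exact h.lead_zero.flip

lemma swap12_x1_pow (b : ℕ) : swap12 (x1 ^ b) = x2 ^ b := by
  rw [map_pow]
  congr 1
  unfold swap12 x1 x2 mono
  refine AddMonoidAlgebra.mapDomain_single.trans ?_
  congr 1
  refine Prod.ext ?_ rfl
  ext i
  fin_cases i <;> rfl

lemma newtonShape_x2_pow (b : ℕ) : NewtonShape 0 b ∅ (x2 ^ b) := by
  rw [← swap12_x1_pow]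
  exact (newtonShape_x1_pow b).swap

/-! ### The diagonal sections -/

/-- The form 1 - W = (x³+y³)W, which drives the cancellation both in the diagonal sections and in
the recursion. -/
lemma fermatInv_eq : fermatInv =
    1 - (HahnSeries.single (3, 0) 1 + HahnSeries.single (0, 3) 1) * fermatInv := by
  have h := fermatInv_mul_fermat
  rw [fermat] at h
  linear_combination h

/-- In this chart x₁x₂ - tx₀² becomes xy(1 - W) = xyW(x³+y³). -/
lemma expand_one_diag (a : ℕ) : expand 1 ((x1 * x2 - tt * x0 ^ 2) ^ a) =
    HahnSeries.single ((a : ℤ), (a : ℤ)) 1 * fermatInv ^ a *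
      (HahnSeries.single (3, 0) 1 + HahnSeries.single (0, 3) 1) ^ a := by
  have h : expand 1 (x1 * x2 - tt * x0 ^ 2) = HahnSeries.single (1, 1) 1 * fermatInv *
      (HahnSeries.single (3, 0) 1 + HahnSeries.single (0, 3) 1) := by
    rw [x1, x2, tt, x0, mono_pow, mono_mul_mono, mono_mul_mono, map_sub, expand_mono, expand_mono,
      tLaurent_eq]
    have h0 : ∀ z : ℤ × ℤ, z = 0 → (HahnSeries.single z 1 : Laurent) = 1 := by
      rintro z rfl
      rfl
    have e1 : (![(0 : ℤ) + 0, 1 + 0, 0 + 1] 1, ![(0 : ℤ) + 0, 1 + 0, 0 + 1] (1 + 1)) =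
      ((1, 1) : ℤ × ℤ) := rfl
    rw [e1, h0 (![_, _, _] 1, _) (by simp)]
    simp only [add_zero, pow_zero, mul_one, mul_zero, pow_one, one_mul]
    linear_combination (-HahnSeries.single ((1 : ℤ), (1 : ℤ)) (1 : ℂ)) * fermatInv_eq
  rw [map_pow, h, mul_pow, mul_pow, HahnSeries.single_pow]
  simp

lemma cube_add_pow_support (a : ℕ) :
    ((HahnSeries.single (3, 0) 1 + HahnSeries.single (0, 3) 1 : Laurent) ^ a).support ⊆
      {z | ∃ k l : ℕ, z = (3 * (k : ℤ), 3 * (l : ℤ)) ∧ k + l = a} := by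
  induction a with
  | zero =>
    intro z hz
    rw [pow_zero, HahnSeries.support_one, Set.mem_singleton_iff] at hz
    exact ⟨0, 0, by rw [hz]; rfl, rfl⟩
  | succ a ih =>
    rw [pow_succ]
    refine support_mul_subset_of ih (B := {(3, 0), (0, 3)}) ?_ ?_
    · intro z hz
      rcases HahnSeries.support_add_subset _ _ hz with h | h
      · exact Or.inl (HahnSeries.support_single_subset h)
      · exact Or.inr (HahnSeries.support_single_subset h)
    · rintro _ ⟨k, l, rfl, hkl⟩ q (rfl | rfl)
      · exact ⟨k + 1, l, by ext <;> simp [mul_add], by omega⟩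
      · exact ⟨k, l + 1, by ext <;> simp [mul_add], by omega⟩

lemma OrdGE.add {ℓ : ℤ × ℤ →+ ℤ} {c : ℤ} {F G : Laurent} (hF : OrdGE ℓ c F) (hG : OrdGE ℓ c G) :
    OrdGE ℓ c (F + G) := fun _ hz => (HahnSeries.support_add_subset _ _ hz).elim (@hF _) (@hG _)

lemma cube_add_pow_sub (a : ℕ) :
    OrdGE expX 3 ((HahnSeries.single (3, 0) 1 + HahnSeries.single (0, 3) 1 : Laurent) ^ a -
      HahnSeries.single (0, 3 * (a : ℤ)) 1) := by
  have hpow : ∀ n : ℕ, (HahnSeries.single (0, 3) 1 : Laurent) ^ n =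
      HahnSeries.single (0, 3 * (n : ℤ)) 1 := by
    intro n
    rw [HahnSeries.single_pow, one_pow]
    congr 2
    ext <;> simp [mul_comm]
  induction a with
  | zero =>
    rw [← hpow, pow_zero, pow_zero, sub_self]
    exact OrdGE.zero _ _
  | succ n ih =>
    have h3 : OrdGE expX 3 (HahnSeries.single (3, 0) 1) := ordGE_single expX (3, 0) 1
    have h0 : ∀ c : ℤ, OrdGE expX 0 (HahnSeries.single (0, c) 1) := fun c =>
      ordGE_single expX (0, c) 1
    have h := (((h3.mono (by norm_num)).add (h0 3)).mul ih).add (h3.mul (h0 (3 * n)))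
    rw [zero_add] at h
    convert h using 1
    rw [← hpow, ← hpow]
    ring

lemma newtonShape_diag (a : ℕ) : NewtonShape a a ∅ ((x1 * x2 - tt * x0 ^ 2) ^ a) := by
  have hlead : Lead ((a : ℤ), (a : ℤ)) (HahnSeries.single ((a : ℤ), (a : ℤ)) 1 * fermatInv ^ a) := by
    simpa using (lead_single ((a : ℤ), (a : ℤ))).mul (lead_fermatInv_pow a)
  have hcol : OrdGE expX (a + 1) (expand 1 ((x1 * x2 - tt * x0 ^ 2) ^ a) -
      HahnSeries.single ((a : ℤ), 3 * (a : ℤ) + a) 1 * fermatInv ^ a) := by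
    have h := (ordGE_expX_of_grid hlead.2).mul (cube_add_pow_sub a)
    rw [mul_sub, ← expand_one_diag, mul_right_comm, HahnSeries.single_mul_single] at h
    refine OrdGE.mono (c := a + 3) ?_ (by omega)
    convert h using 4
    · simp [add_comm]
    · simp
  have hflip : flip (expand 1 ((x1 * x2 - tt * x0 ^ 2) ^ a)) =
      expand 1 ((x1 * x2 - tt * x0 ^ 2) ^ a) := by
    rw [expand_one_diag, map_mul, map_mul, map_pow, map_pow, map_add, flip_single, flip_single,
      flip_single, flip_fermatInv, add_comm (HahnSeries.single _ _)]
  refine ⟨fun z hz => ?_, fun _ => hcol, fun _ => ?_, ?_, ?_⟩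
  · rw [expand_one_diag] at hz
    have := support_mul_subset_of hlead.2 (cube_add_pow_support a) (C := {z | ∃ m s : ℕ,
      z = ((a : ℤ) + 3 * m, (a : ℤ) + 3 * s) ∧ a * a ≤ a * m + a * s}) (by
        rintro _ ⟨k, l, rfl⟩ _ ⟨k', l', rfl, h⟩
        refine ⟨k + k', l + l', ?_, by nlinarith⟩
        ext <;> simp <;> ring) hz
    obtain ⟨m, s, h1, h2⟩ := this
    exact ⟨m, s, h1, Or.inl h2⟩
  · have h := hcol.flip_expX
    rwa [map_sub, map_mul, map_pow flip fermatInv, flip_fermatInv, flip_single, hflip,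
      add_comm (3 * (a : ℤ))] at h
  · rw [x1, x2, tt, x0, mono_pow, mono_mul_mono, mono_mul_mono, map_pow, map_sub]
    have h := ((lead_mono_zero (0 + 0) (0 + 0) (1 + 0) (0 + 1)).sub_of_ne
      (lead_mono_zero (1 + 2 * 0) (0 + (2 : ℕ) * 1) (0 + (2 : ℕ) * 0) (0 + (2 : ℕ) * 0)).2
      ⟨1, 0, by simp⟩ (by simp)).pow a
    simpa using h
  · rw [x1, x2, tt, x0, mono_pow, mono_mul_mono, mono_mul_mono, map_pow, map_sub]
    have h := ((lead_mono_two (0 + 0) (0 + 0) (1 + 0) (0 + 1)).sub_of_ne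
      (lead_mono_two (1 + 2 * 0) (0 + (2 : ℕ) * 1) (0 + (2 : ℕ) * 0) (0 + (2 : ℕ) * 0)).2
      ⟨0, 1, by simp⟩ (by simp)).pow a
    simpa using h

/-! ### The first step of the recursion -/

/-- With denominators cleared, a bad point is strictly below the segment of S(a,b), while the last
inequality, (a-1)b ≤ (a-1)m + bs, puts it on or above the segment of x₁S(a-1,b). -/
lemma mem_badSet_iff {a b m s : ℕ} (hb : 1 ≤ b) : (m, s) ∈ badSet a b ↔
    0 < m ∧ 0 < s ∧ a * m + b * s < a * b ∧ a * b + m ≤ a * m + b * s + b := by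
  have hb' : (0 : ℚ) < b := by exact_mod_cast hb
  have e1 : (a : ℚ) / b * m < a - s ↔ a * m + b * s < a * b := by
    rw [div_mul_eq_mul_div, div_lt_iff₀ hb']
    constructor
    · intro h
      have : (a * m + b * s : ℚ) < a * b := by linarith
      exact_mod_cast this
    · intro h
      have : (a * m + b * s : ℚ) < a * b := by exact_mod_cast h
      linarith
  have e2 : (a : ℚ) - s ≤ (a - 1) / b * m + 1 ↔ a * b + m ≤ a * m + b * s + b := by
    rw [div_mul_eq_mul_div, ← sub_le_iff_le_add, le_div_iff₀ hb']
    constructor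
    · intro h
      have : (a * b + m : ℚ) ≤ a * m + b * s + b := by linarith
      exact_mod_cast this
    · intro h
      have : (a * b + m : ℚ) ≤ a * m + b * s + b := by exact_mod_cast h
      linarith
  rw [← e1, ← e2]
  rfl

/-- Both summands lie above the segment from (0,a-1) to (b,0), up to points already above the new
one. Points with m = 0 or s = 0 are controlled by the edge series, so anything else below the new
segment is bad. -/
lemma newtonShape_first {a b : ℕ} (hb : 1 ≤ b) (hab : b < a) {F G : Expr}
    (hF : NewtonShape (a - 1) b ∅ F) (hG : NewtonShape (a - 2) (b + 1) ∅ G) :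
    NewtonShape a b (badSet a b) (x1 * F - tt ^ 2 * x0 * G) := by
  obtain ⟨c, rfl⟩ : ∃ c, a = c + 2 := ⟨a - 2, by omega⟩
  rw [show c + 2 - 1 = c + 1 by omega] at hF
  rw [show c + 2 - 2 = c by omega] at hG
  have hm : tt ^ 2 * x0 = mono 2 1 0 0 := by
    rw [tt, x0, mono_pow, mono_mul_mono]
    simp
  have l1 : expand 1 x1 = HahnSeries.single (1, 0) 1 := by
    rw [x1, expand_mono]
    simp
  have l2 : expand 1 (mono 2 1 0 0) = HahnSeries.single (2, 2) 1 * fermatInv ^ 2 := by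
    rw [expand_mono, tLaurent_eq, mul_pow, HahnSeries.single_pow, ← mul_assoc,
      HahnSeries.single_mul_single]
    simp
  have hx : Lead ((1 : ℤ), (0 : ℤ)) (HahnSeries.single (1, 0) 1) := lead_single _
  have ht : Lead ((2 : ℤ), (2 : ℤ)) (expand 1 (mono 2 1 0 0)) := by
    simpa using lead_mono_one 2 1 0 0
  have e : expand 1 (x1 * F - tt ^ 2 * x0 * G) = HahnSeries.single (1, 0) 1 * expand 1 F -
      expand 1 (mono 2 1 0 0) * expand 1 G := by
    rw [hm, map_sub, map_mul, map_mul, l1]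
  have hcol : OrdGE expX (((c + 2 : ℕ) : ℤ) + 1) (expand 1 (x1 * F - tt ^ 2 * x0 * G) -
      HahnSeries.single (((c + 2 : ℕ) : ℤ), 3 * ((c + 2 : ℕ) : ℤ) + b) 1 * fermatInv ^ (c + 2)) := by
    have h1 := (ordGE_expX_of_grid hx.2).mul (hF.column hb)
    have h2 := (ordGE_expX_of_grid ht.2).mul (hG.column (by omega))
    -- With a = c+2, the column difference is x^a y^(3a+b-3)(x³+y³)W^a. Its y³ part is the claimed
    -- column; this is the x³ part, of higher x-order.
    have h3 : OrdGE expX ((c : ℤ) + 5) (HahnSeries.single ((c : ℤ) + 5, 3 * (c : ℤ) + b + 3) 1 *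
        fermatInv ^ (c + 2)) := by
      simpa using (ordGE_single expX ((c : ℤ) + 5, 3 * (c : ℤ) + b + 3) 1).mul
        (ordGE_expX_of_grid (lead_fermatInv_pow (c + 2)).2)
    have h := ((h1.mono (d := (c : ℤ) + 3) (by push_cast; omega)).sub
      (h2.mono (d := (c : ℤ) + 3) (by push_cast; omega))).add
      (h3.mono (d := (c : ℤ) + 3) (by omega))
    rw [e]
    convert h using 1
    · push_cast; ring
    · have s1 : (HahnSeries.single (1, 0) 1 : Laurent) *
          HahnSeries.single (((c + 1 : ℕ) : ℤ), 3 * ((c + 1 : ℕ) : ℤ) + b) 1 =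
          HahnSeries.single ((c : ℤ) + 2, 3 * (c : ℤ) + b + 3) 1 := by
        rw [HahnSeries.single_mul_single, one_mul]
        congr 2
        ext <;> simp <;> ring
      have s2 : (HahnSeries.single (2, 2) 1 : Laurent) *
          HahnSeries.single ((c : ℤ), 3 * (c : ℤ) + ((b + 1 : ℕ) : ℤ)) 1 =
          HahnSeries.single ((c : ℤ) + 2, 3 * (c : ℤ) + b + 3) 1 := by
        rw [HahnSeries.single_mul_single, one_mul]
        congr 2
        ext <;> simp <;> ring
      have s3 : (HahnSeries.single ((c : ℤ) + 2, 3 * (c : ℤ) + b + 3) 1 : Laurent) *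
          HahnSeries.single (3, 0) 1 = HahnSeries.single ((c : ℤ) + 5, 3 * (c : ℤ) + b + 3) 1 := by
        rw [HahnSeries.single_mul_single, one_mul]
        congr 2
      have s4 : (HahnSeries.single ((c : ℤ) + 2, 3 * (c : ℤ) + b + 3) 1 : Laurent) *
          HahnSeries.single (0, 3) 1 =
          HahnSeries.single (((c + 2 : ℕ) : ℤ), 3 * ((c + 2 : ℕ) : ℤ) + b) 1 := by
        rw [HahnSeries.single_mul_single, one_mul]
        congr 2
        ext
        · simp
        · simp
          ring
      rw [← s3, ← s4, l2, mul_sub, mul_sub, ← mul_assoc _ (HahnSeries.single _ _), s1,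
        mul_mul_mul_comm, s2]
      have hW := fermatInv_eq
      linear_combination (-HahnSeries.single ((c : ℤ) + 2, 3 * (c : ℤ) + b + 3) (1 : ℂ)) *
        fermatInv ^ (c + 1) * hW
  have hrow : OrdGE expY ((b : ℤ) + 1) (expand 1 (x1 * F - tt ^ 2 * x0 * G) -
      HahnSeries.single (((c + 2 : ℕ) : ℤ) + 3 * b, (b : ℤ)) 1 * fermatInv ^ b) := by
    have h1 := (ordGE_expY_of_grid hx.2).mul (hF.row (by omega))
    have h2 : OrdGE expY ((b : ℤ) + 1) (expand 1 G) := by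
      intro z hz
      obtain ⟨m, s, rfl, -⟩ := hG.polygon z hz
      simp only [Set.mem_ofPred_eq, AddMonoidHom.coe_snd]
      omega
    have h := (h1.mono (d := (b : ℤ) + 1) (by simp)).sub
      (((ordGE_expY_of_grid ht.2).mul h2).mono (d := (b : ℤ) + 1) (by omega))
    rw [e]
    convert h using 1
    rw [mul_sub, ← mul_assoc, HahnSeries.single_mul_single]
    have : ((1 : ℤ), (0 : ℤ)) + (((c + 1 : ℕ) : ℤ) + 3 * b, (b : ℤ)) =
        (((c + 2 : ℕ) : ℤ) + 3 * b, (b : ℤ)) := by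
      ext <;> simp; ring
    rw [this, one_mul]
    ring
  refine ⟨fun z hz => ?_, fun _ => hcol, fun _ => hrow, ?_, ?_⟩
  -- A term of the second summand with s ≥ a escapes the segment estimate, but is good by itself
  -- since bs ≥ ab.
  · have hz' : ∃ m s : ℕ, z = (((c + 2 : ℕ) : ℤ) + 3 * m, (b : ℤ) + 3 * s) ∧
        ((c + 1) * b ≤ (c + 1) * m + b * s ∨ c + 2 ≤ s) := by
      rw [e] at hz
      refine support_sub_subset_of (A := {z | ∃ m s : ℕ,
        z = (((c + 2 : ℕ) : ℤ) + 3 * m, (b : ℤ) + 3 * s) ∧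
        ((c + 1) * b ≤ (c + 1) * m + b * s ∨ c + 2 ≤ s)}) ?_ ?_ hz
      · refine support_mul_subset_of HahnSeries.support_single_subset
          (fun z hz => hF.polygon z hz) ?_
        rintro _ rfl _ ⟨m, s, rfl, h⟩
        simp only [Set.mem_empty_iff_false, or_false] at h
        refine ⟨m, s, ?_, Or.inl h⟩
        ext <;> simp; ring
      · refine support_mul_subset_of ht.2 (fun z hz => hG.polygon z hz) ?_
        rintro _ ⟨k, l, rfl⟩ _ ⟨m, s, rfl, h⟩
        simp only [Set.mem_empty_iff_false, or_false] at h
        refine ⟨k + m, l + s + 1, ?_, ?_⟩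
        · ext <;> simp <;> ring
        · by_cases hs : c + 2 ≤ l + s + 1
          · exact Or.inr hs
          · left
            have : s ≤ c := by omega
            nlinarith
    obtain ⟨m, s, rfl, h⟩ := hz'
    refine ⟨m, s, rfl, ?_⟩
    rw [mem_badSet_iff hb]
    by_contra hcon
    push Not at hcon
    obtain ⟨hlt, hcon⟩ := hcon
    have h' : (c + 1) * b ≤ (c + 1) * m + b * s := by
      rcases h with h | h
      · exact h
      · nlinarith
    apply hz
    -- For m = 0 the coefficient is that of the column series, which starts at s = a; for s = 0 the
    -- row series starts at m = b. Neither has a term below the segment.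
    rcases Nat.eq_zero_or_pos m with rfl | hm0
    · have h0 := hcol.coeff_eq_zero (z := (((c + 2 : ℕ) : ℤ) + 3 * (0 : ℕ), (b : ℤ) + 3 * s))
        (by simp)
      rw [HahnSeries.coeff_sub, sub_eq_zero] at h0
      rw [h0]
      by_contra hne
      obtain ⟨k, l, hkl⟩ := ((lead_single _).mul (lead_fermatInv_pow _)).2 hne
      have hs : s < c + 2 := by
        by_contra hs
        push Not at hs
        nlinarith
      simp only [Prod.ext_iff, Prod.fst_add, Prod.snd_add, Prod.fst_zero, Prod.snd_zero] at hkl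
      omega
    rcases Nat.eq_zero_or_pos s with rfl | hs0
    · have h0 := hrow.coeff_eq_zero (z := (((c + 2 : ℕ) : ℤ) + 3 * m, (b : ℤ) + 3 * (0 : ℕ)))
        (by simp)
      rw [HahnSeries.coeff_sub, sub_eq_zero] at h0
      rw [h0]
      by_contra hne
      obtain ⟨k, l, hkl⟩ := ((lead_single _).mul (lead_fermatInv_pow _)).2 hne
      have hs : m < b := by
        by_contra hs
        push Not at hs
        nlinarith
      simp only [Prod.ext_iff, Prod.fst_add, Prod.snd_add, Prod.fst_zero, Prod.snd_zero] at hkl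
      omega
    · have := hcon hm0 hs0 hlt
      nlinarith
  · rw [hm, x1, map_sub, map_mul, map_mul]
    have h := ((lead_mono_zero 0 0 1 0).mul hF.lead_zero).sub_of_ne
      ((lead_mono_zero 2 1 0 0).mul hG.lead_zero).2 ⟨1, 0, by ext <;> simp; ring⟩ (by simp)
    convert h using 1
    ext <;> simp; ring
  · rw [hm, x1, map_sub, map_mul, map_mul]
    have h := ((lead_mono_two 0 0 1 0).mul hF.lead_two).sub_of_ne
      ((lead_mono_two 2 1 0 0).mul hG.lead_two).2 ⟨1, 1, by ext <;> simp; ring⟩ (by simp)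
    convert h using 1
    ext <;> simp

/-! ### The correction of a bad term -/

/-- The properties of the term which is subtracted in order to remove the bad term `(m, s)`: its
leading coefficient, and the position of its exponents in the three charts. -/
structure Correction (a b m s : ℕ) (C : Expr) : Prop where
  coeff_eq : (expand 1 C).coeff ((a : ℤ) + 3 * m, (b : ℤ) + 3 * s) = 1
  polygon : ∀ z ∈ (expand 1 C).support, ∃ m' s' : ℕ, z = ((a : ℤ) + 3 * m', (b : ℤ) + 3 * s') ∧
    ((m', s') = (m, s) ∨ a * b ≤ a * m' + b * s' ∨ (m', s') ∈ badSet a b ∧ m < m')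
  column : OrdGE expX (a + 1) (expand 1 C)
  row : OrdGE expY (b + 1) (expand 1 C)
  chart_zero : ∃ q ∈ grid (0, (a : ℤ)), q ≠ (0, (a : ℤ)) ∧ (expand 0 C).support ⊆ grid q
  chart_two : ∃ q ∈ grid ((b : ℤ), 0), q ≠ ((b : ℤ), 0) ∧ (expand 2 C).support ⊆ grid q

/-- One step up from a bad point is already good, and a step to the right is good or bad with larger
m. Divisibility by 3 in `hi` places the leading exponents in the other charts on the required grids,
even when i is negative. -/
lemma correction_mono {a b m s : ℕ} (hb : 1 ≤ b) (hms : (m, s) ∈ badSet a b) (e l : ℕ)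
    (i j k : ℤ) (hi : i + e = 3 * l) (hj : j + e = a + 3 * m) (hk : k + e = b + 3 * s) :
    Correction a b m s (mono e i j k) := by
  obtain ⟨hm, hs, h1, h2⟩ := (mem_badSet_iff hb).1 hms
  have hL := lead_mono_one e i j k
  rw [hj, hk] at hL
  refine ⟨hL.1, fun z hz => ?_, ?_, ?_, ?_, ?_⟩
  · obtain ⟨k', l', rfl⟩ := hL.2 hz
    refine ⟨m + k', s + l', by ext <;> simp <;> ring, ?_⟩
    rcases Nat.eq_zero_or_pos l' with rfl | hl
    · rcases Nat.eq_zero_or_pos k' with rfl | hk'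
      · exact Or.inl rfl
      · right
        by_cases hgood : a * b ≤ a * (m + k') + b * (s + 0)
        · exact Or.inl hgood
        · refine Or.inr ⟨(mem_badSet_iff hb).2 ⟨by omega, by omega, by omega, ?_⟩, by omega⟩
          have : 1 ≤ a := by
            rcases Nat.eq_zero_or_pos a with rfl | h
            · omega
            · exact h
          nlinarith
    · right; left
      nlinarith [Nat.zero_le (a * k')]
  · exact (ordGE_expX_of_grid hL.2).mono (by simp only; omega)
  · exact (ordGE_expY_of_grid hL.2).mono (by simp only; omega)
  · refine ⟨_, ⟨l, m, ?_⟩, ?_, (lead_mono_zero e i j k).2⟩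
    · rw [hi, hj]
      simp
    · simp only [ne_eq, Prod.ext_iff]
      omega
  · refine ⟨_, ⟨s, l, ?_⟩, ?_, (lead_mono_two e i j k).2⟩
    · rw [hi, hk]
      simp
    · simp only [ne_eq, Prod.ext_iff]
      omega

/-- Since α/β ≤ (a-1)/b, the segment of S(α,β) is no steeper than that of x₁S(a-1,b). Placed with
its upper end at a bad point, it stays above the lower bound that defines badness. -/
lemma slope_le {a b α β M N : ℕ} (hα : α + 1 ≤ a) (hβ : b ≤ β) (hβ0 : 0 < β)
    (h : α * β ≤ α * M + β * N) : b * α + M ≤ a * M + b * N := by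
  have h1 := Nat.mul_le_mul_right β hα
  have h2 := Nat.mul_le_mul_left α hβ
  have h3 : b * α + β ≤ a * β := by linarith
  have h4 := Nat.mul_le_mul_left M h3
  have h5 := Nat.mul_le_mul_left b h
  have h6 : β * (b * α + M) ≤ β * (a * M + b * N) := by linarith
  exact Nat.le_of_mul_le_mul_left h6 hβ0

/-- The prefactor translates the polygon of S(α,β) by (m,w), so that its upper corner (0,α) falls on
(m,s), where the column series gives coefficient 1. Everything else is higher in the same column or
further right. -/
lemma correction_section {a b m s α β e w : ℕ} (hb : 1 ≤ b) (hms : (m, s) ∈ badSet a b)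
    (hα : α + 2 * m + a = 2 * s) (hβ : β + s = a + b + m) (he : e + 2 * s = 2 * a + 5 * m)
    (hw : w + s = a + 2 * m) (hsa : s < a) {G : Expr} (hG : NewtonShape α β ∅ G) (d : ℤ)
    (hd : d = s - m) : Correction a b m s (mono e (a - d) 0 0 * G) := by
  obtain ⟨hm, hs, h1, h2⟩ := (mem_badSet_iff hb).1 hms
  have hL : Lead ((e : ℤ), (e : ℤ)) (expand 1 (mono e (a - d) 0 0)) := by
    simpa using lead_mono_one e (a - d) 0 0
  have hα' : (e : ℤ) + α = a + 3 * m := by omega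
  have hβ' : (e : ℤ) + β = b + 3 * w := by omega
  have hβ0 : 0 < β := by omega
  have hX : OrdGE expX α (expand 1 G) := by
    intro z hz
    obtain ⟨m', s', rfl, -⟩ := hG.polygon z hz
    simp
  have hY : OrdGE expY β (expand 1 G) := by
    intro z hz
    obtain ⟨m', s', rfl, -⟩ := hG.polygon z hz
    simp
  refine ⟨?_, fun z hz => ?_, ?_, ?_, ?_, ?_⟩
  · have h := ((ordGE_expX_of_grid hL.2).mul (hG.column hβ0)).coeff_eq_zero
      (z := ((a : ℤ) + 3 * m, (b : ℤ) + 3 * s)) (by simp only [AddMonoidHom.coe_fst]; omega)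
    rw [mul_sub, HahnSeries.coeff_sub, sub_eq_zero] at h
    rw [map_mul, h]
    have h' := hL.mul ((lead_single ((α : ℤ), 3 * (α : ℤ) + β)).mul (lead_fermatInv_pow α))
    have e1 : ((e : ℤ), (e : ℤ)) + (((α : ℤ), 3 * (α : ℤ) + β) + 0) =
        ((a : ℤ) + 3 * m, (b : ℤ) + 3 * s) := by
      ext <;> simp <;> omega
    rw [e1] at h'
    exact h'.1
  · rw [map_mul] at hz
    refine support_mul_subset_of (C := {z | ∃ m' s' : ℕ,
      z = ((a : ℤ) + 3 * m', (b : ℤ) + 3 * s') ∧ ((m', s') = (m, s) ∨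
        a * b ≤ a * m' + b * s' ∨ (m', s') ∈ badSet a b ∧ m < m')})
      hL.2 (fun z hz => hG.polygon z hz) ?_ hz
    rintro _ ⟨k, l, rfl⟩ _ ⟨m', s', rfl, h⟩
    simp only [Set.mem_empty_iff_false, or_false] at h
    refine ⟨m + (k + m'), w + (l + s'), ?_, ?_⟩
    · ext
      · simp only [Prod.fst_add]
        omega
      · simp only [Prod.snd_add]
        omega
    have h' : α * β ≤ α * (k + m') + β * (l + s') := by
      nlinarith [Nat.zero_le (α * k), Nat.zero_le (β * l)]
    generalize k + m' = M at h' ⊢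
    generalize l + s' = N at h' ⊢
    rcases Nat.eq_zero_or_pos M with rfl | hM
    · have hN : β * α ≤ β * N := by linarith
      -- In the column of the bad point, a term is either the corner itself or at least one step
      -- above it, hence good.
      rcases (Nat.le_of_mul_le_mul_left hN hβ0).eq_or_lt with rfl | hN
      · left
        rw [add_zero, show w + α = s by omega]
      · right; left
        have : b * (s + 1) ≤ b * (w + N) := Nat.mul_le_mul_left b (by omega)
        linarith
    · right
      by_cases hgood : a * b ≤ a * (m + M) + b * (w + N)
      · exact Or.inl hgood
      refine Or.inr ⟨(mem_badSet_iff hb).2 ⟨by omega, by omega, by omega, ?_⟩, by omega⟩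
      have := slope_le (by omega : α + 1 ≤ a) (by omega : b ≤ β) hβ0 h'
      have : b * s = b * w + b * α := by
        rw [← mul_add]
        congr 1
        omega
      linarith
  · rw [map_mul]
    exact ((ordGE_expX_of_grid hL.2).mul hX).mono (by simp only; omega)
  · rw [map_mul]
    exact ((ordGE_expY_of_grid hL.2).mul hY).mono (by simp only; omega)
  · rw [map_mul]
    refine ⟨_, ⟨w, m, ?_⟩, ?_, ((lead_mono_zero e (a - d) 0 0).mul hG.lead_zero).2⟩
    · ext <;> simp <;> omega
    · simp only [ne_eq, Prod.ext_iff, Prod.fst_add, Prod.snd_add]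
      omega
  · rw [map_mul]
    refine ⟨_, ⟨w, w, ?_⟩, ?_, ((lead_mono_two e (a - d) 0 0).mul hG.lead_two).2⟩
    · ext <;> simp <;> omega
    · simp only [ne_eq, Prod.ext_iff, Prod.fst_add, Prod.snd_add]
      omega

/-! ### Successive removal of the bad terms -/

lemma correct_eq {a b m s : ℕ} (hb : 1 ≤ b) (hms : (m, s) ∈ badSet a b) {F : ℕ → ℕ → Expr}
    (hF : ∀ α β, 1 ≤ α → 1 ≤ β → α + β < a + b → NewtonShape α β ∅ (F α β)) (R : Expr) :
    ∃ C, Correction a b m s C ∧ correct F a b R (m, s) =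
      R - (expand 1 R).coeff ((a : ℤ) + 3 * m, (b : ℤ) + 3 * s) • C := by
  obtain ⟨hm, hs, h1, h2⟩ := (mem_badSet_iff hb).1 hms
  have hsa : s < a := by
    by_contra h
    push Not at h
    nlinarith
  have hmb : m < b := by
    by_contra h
    push Not at h
    nlinarith
  unfold correct
  dsimp only
  -- If 3d > 2a, then 2d - a and a + b - d are positive with sum b + d < a + b, so truncation is
  -- harmless and the induction hypothesis applies. The auxiliary numbers below are one third of the
  -- x₀-exponent plus the t-exponent.
  split_ifs with c1 c2
  · refine ⟨_, ?_, rfl⟩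
    exact correction_section (w := a + 2 * m - s) hb hms (by omega) (by omega) (by omega) (by omega)
      hsa (hF _ _ (by omega) (by omega) (by omega)) _ rfl
  · refine ⟨_, ?_, rfl⟩
    exact correction_mono hb hms _ (a + 2 * m - s) _ _ _ (by omega) (by omega) (by omega)
  · refine ⟨_, ?_, rfl⟩
    exact correction_mono hb hms _ (b + 2 * s - m) _ _ _ (by omega) (by omega) (by omega)

lemma NewtonShape.correct {a b m s : ℕ} {A : Set (ℕ × ℕ)} {R C : Expr} (h : NewtonShape a b A R)
    (hC : Correction a b m s C) (B : Set (ℕ × ℕ)) (hAB : ∀ q ∈ A, q = (m, s) ∨ q ∈ B)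
    (hB : ∀ q ∈ badSet a b, m < q.1 → q ∈ B) :
    NewtonShape a b B (R - (expand 1 R).coeff ((a : ℤ) + 3 * m, (b : ℤ) + 3 * s) • C) where
  polygon z hz := by
    have hz' : ∃ m' s' : ℕ, z = ((a : ℤ) + 3 * m', (b : ℤ) + 3 * s') ∧
        (a * b ≤ a * m' + b * s' ∨ (m', s') ∈ B ∨ (m', s') = (m, s)) := by
      rw [map_sub, map_smul] at hz
      refine support_sub_subset_of (A := {z | ∃ m' s' : ℕ,
        z = ((a : ℤ) + 3 * m', (b : ℤ) + 3 * s') ∧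
        (a * b ≤ a * m' + b * s' ∨ (m', s') ∈ B ∨ (m', s') = (m, s))})
        ?_ (support_smul_subset_of _ ?_) hz
      · intro z hz
        obtain ⟨m', s', hz, h'⟩ := h.polygon z hz
        refine ⟨m', s', hz, h'.imp_right fun h' => (hAB _ h').symm⟩
      · intro z hz
        obtain ⟨m', s', hz, h' | h' | ⟨h', h''⟩⟩ := hC.polygon z hz
        · exact ⟨m', s', hz, Or.inr (Or.inr h')⟩
        · exact ⟨m', s', hz, Or.inl h'⟩
        · exact ⟨m', s', hz, Or.inr (Or.inl (hB _ h' h''))⟩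
    obtain ⟨m', s', rfl, h' | h' | h'⟩ := hz'
    · exact ⟨m', s', rfl, Or.inl h'⟩
    · exact ⟨m', s', rfl, Or.inr h'⟩
    · exfalso
      obtain ⟨rfl, rfl⟩ := Prod.mk.inj h'
      apply hz
      rw [map_sub, map_smul, HahnSeries.coeff_sub, HahnSeries.coeff_smul, hC.coeff_eq, smul_eq_mul,
        mul_one, sub_self]
  column hb := by
    rw [map_sub, map_smul, sub_right_comm]
    exact (h.column hb).sub (hC.column.smul _)
  row ha := by
    rw [map_sub, map_smul, sub_right_comm]
    exact (h.row ha).sub (hC.row.smul _)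
  lead_zero := by
    obtain ⟨q, hq, hne, hsupp⟩ := hC.chart_zero
    rw [map_sub, map_smul]
    exact h.lead_zero.sub_of_ne (support_smul_subset_of _ hsupp) hq hne
  lead_two := by
    obtain ⟨q, hq, hne, hsupp⟩ := hC.chart_two
    rw [map_sub, map_smul]
    exact h.lead_two.sub_of_ne (support_smul_subset_of _ hsupp) hq hne

/-- The invariant is that the remaining list contains every bad point to the right of any of its
members, so whatever a correction creates is still due for treatment. -/
lemma NewtonShape.foldl_correct {a b : ℕ} (hb : 1 ≤ b) {F : ℕ → ℕ → Expr}
    (hF : ∀ α β, 1 ≤ α → 1 ≤ β → α + β < a + b → NewtonShape α β ∅ (F α β)) (L : List (ℕ × ℕ))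
    (hsorted : L.Pairwise (fun p q => p.1 < q.1)) (hbad : ∀ p ∈ L, p ∈ badSet a b)
    (htail : ∀ p ∈ L, ∀ q ∈ badSet a b, p.1 < q.1 → q ∈ L) {R : Expr}
    (hR : NewtonShape a b {p | p ∈ L} R) :
    NewtonShape a b ∅ (L.foldl (FermatCubic.correct F a b) R) := by
  induction L generalizing R with
  | nil => simpa using hR
  | cons p L ih =>
    obtain ⟨m, s⟩ := p
    rw [List.pairwise_cons] at hsorted
    obtain ⟨C, hC, hCR⟩ := correct_eq hb (hbad _ List.mem_cons_self) hF R
    rw [List.foldl_cons, hCR]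
    refine ih hsorted.2 (fun p hp => hbad p (List.mem_cons_of_mem _ hp)) ?_
      (hR.correct hC _ (fun q hq => List.mem_cons.1 hq) ?_)
    · intro p hp q hq hpq
      rcases List.mem_cons.1 (htail p (List.mem_cons_of_mem _ hp) q hq hpq) with rfl | h
      · exact absurd (hsorted.1 p hp) hpq.not_gt
      · exact h
    · intro q hq hmq
      rcases List.mem_cons.1 (htail _ List.mem_cons_self q hq hmq) with rfl | h
      · exact absurd hmq (lt_irrefl _)
      · exact h

/-- The Newton polygons of the sections `S(a,b)`. -/
theorem newtonShape_S (a b : ℕ) : NewtonShape a b ∅ (S a b) := by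
  induction h : a + b using Nat.strong_induction_on generalizing a b with
  | _ n ih =>
    have ih' : ∀ α β, α + β < n → NewtonShape α β ∅ (S α β) := fun α β hlt => ih _ hlt α β rfl
    have hlt : ∀ {a b : ℕ}, 1 ≤ b → b < a → a + b = n → NewtonShape a b ∅ (S a b) := by
      intro a b hb hab h
      rw [S_of_lt hb hab, lastTerm]
      refine NewtonShape.foldl_correct hb (fun α β _ _ hlt => ih' α β (h ▸ hlt)) _
        (badList_sorted hb) (fun p hp => (mem_badList hb).1 hp)
        (fun p _ q hq _ => (mem_badList hb).2 hq) ?_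
      rw [show {p | p ∈ badList a b} = badSet a b from Set.ext fun p => mem_badList hb]
      exact newtonShape_first hb hab (ih' _ _ (by omega)) (ih' _ _ (by omega))
    rcases Nat.eq_zero_or_pos b with rfl | hb
    · rw [S, if_pos rfl]
      exact newtonShape_x1_pow a
    rcases Nat.eq_zero_or_pos a with rfl | ha
    · rw [S, if_neg (by omega), if_pos rfl]
      exact newtonShape_x2_pow b
    rcases lt_trichotomy a b with hab | rfl | hab
    · rw [S_of_gt ha hab]
      exact (hlt ha hab (by omega)).swap
    · rw [S, if_neg (by omega), if_neg (by omega), if_pos rfl]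
      exact newtonShape_diag a
    · exact hlt hb hab h

/-! ### The valuations of the sections -/

lemma weightVal_eq {r v : ℝ} {F : Laurent} (hle : ∀ z ∈ F.support, v ≤ (1 - r) * z.1 + r * z.2)
    (z : ℤ × ℤ) (hz : F.coeff z ≠ 0) (hv : (1 - r) * z.1 + r * z.2 = v) :
    weightVal r F = (v : EReal) := by
  unfold weightVal
  refine le_antisymm ?_ (le_iInf₂ fun p hp => EReal.coe_le_coe_iff.2 (hle p hp))
  exact (iInf₂_le z hz).trans (EReal.coe_le_coe_iff.2 hv.le)

lemma Lead.weightVal {r : ℝ} (hr : r ∈ Set.Icc (0 : ℝ) 1) {p : ℤ × ℤ} {F : Laurent}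
    (hF : Lead p F) : weightVal r F = (((1 - r) * p.1 + r * p.2 : ℝ) : EReal) := by
  refine weightVal_eq (fun z hz => ?_) p (by rw [hF.1]; exact one_ne_zero) rfl
  obtain ⟨k, l, rfl⟩ := hF.2 hz
  push_cast
  have := mul_nonneg (sub_nonneg.2 hr.2) (Nat.cast_nonneg (α := ℝ) k)
  have := mul_nonneg hr.1 (Nat.cast_nonneg (α := ℝ) l)
  linarith

lemma NewtonShape.coeff_column {a b : ℕ} {A : Set (ℕ × ℕ)} {R : Expr} (h : NewtonShape a b A R)
    (hb : 0 < b) : (expand 1 R).coeff ((a : ℤ), 3 * (a : ℤ) + b) = 1 := by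
  have h0 := (h.column hb).coeff_eq_zero (z := ((a : ℤ), 3 * (a : ℤ) + b)) (by simp)
  rw [HahnSeries.coeff_sub, sub_eq_zero] at h0
  rw [h0]
  simpa using ((lead_single ((a : ℤ), 3 * (a : ℤ) + b)).mul (lead_fermatInv_pow a)).1

lemma NewtonShape.coeff_row {a b : ℕ} {A : Set (ℕ × ℕ)} {R : Expr} (h : NewtonShape a b A R)
    (ha : 0 < a) : (expand 1 R).coeff ((a : ℤ) + 3 * b, (b : ℤ)) = 1 := by
  have h0 := (h.row ha).coeff_eq_zero (z := ((a : ℤ) + 3 * b, (b : ℤ))) (by simp)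
  rw [HahnSeries.coeff_sub, sub_eq_zero] at h0
  rw [h0]
  simpa using ((lead_single ((a : ℤ) + 3 * b, (b : ℤ))).mul (lead_fermatInv_pow b)).1

lemma NewtonShape.val_one {a b : ℕ} (ha : 0 < a) (hb : 0 < b) {r : ℝ} (hr : r ∈ Set.Icc (0 : ℝ) 1)
    {R : Expr} (h : NewtonShape a b ∅ R) : val 1 r R =
      ((min (a + (2 * a + b) * r) (a + 3 * b - (a + 2 * b) * r) : ℝ) : EReal) := by
  have ha' : (0 : ℝ) < a := by exact_mod_cast ha
  have hb' : (0 : ℝ) < b := by exact_mod_cast hb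
  have key : ∀ z ∈ (expand 1 R).support, ∃ m s : ℝ, 0 ≤ m ∧ 0 ≤ s ∧ a * b ≤ a * m + b * s ∧
      (1 - r) * z.1 + r * z.2 = (1 - r) * a + r * b + 3 * ((1 - r) * m + r * s) := by
    intro z hz
    obtain ⟨m, s, rfl, hms⟩ := h.polygon z hz
    simp only [Set.mem_empty_iff_false, or_false] at hms
    refine ⟨m, s, by positivity, by positivity, by exact_mod_cast hms, ?_⟩
    push_cast
    ring
  have h1r := sub_nonneg.2 hr.2
  -- Relative to (a,b), the corners (0,a) and (b,0) have weights 3ra and 3(1-r)b; the smaller one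
  -- bounds the whole polygon.
  rcases le_total (r * a) ((1 - r) * b) with hle | hle
  · refine weightVal_eq (fun z hz => ?_) ((a : ℤ), 3 * (a : ℤ) + b)
      (by rw [h.coeff_column hb]; exact one_ne_zero) ?_
    · obtain ⟨m, s, hm, hs, hms, e⟩ := key z hz
      rw [e]
      refine (min_le_left _ _).trans ?_
      have : b * (r * a) ≤ b * ((1 - r) * m + r * s) := by
        nlinarith [mul_le_mul_of_nonneg_right hle hm, mul_le_mul_of_nonneg_left hms hr.1]
      have := le_of_mul_le_mul_left this hb'
      linarith
    · rw [min_eq_left (by linarith)]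
      push_cast
      ring
  · refine weightVal_eq (fun z hz => ?_) ((a : ℤ) + 3 * b, (b : ℤ))
      (by rw [h.coeff_row ha]; exact one_ne_zero) ?_
    · obtain ⟨m, s, hm, hs, hms, e⟩ := key z hz
      rw [e]
      refine (min_le_right _ _).trans ?_
      have : a * ((1 - r) * b) ≤ a * ((1 - r) * m + r * s) := by
        nlinarith [mul_le_mul_of_nonneg_right hle hs, mul_le_mul_of_nonneg_left hms h1r]
      have := le_of_mul_le_mul_left this ha'
      linarith
    · rw [min_eq_right (by linarith)]
      push_cast
      ring

/-! ### The cost function -/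

/-- The j-th translate exceeds ut by 3j(u - 3t - 3/2) - 27j²/2. This is nonpositive for every
integer j once |u - 3t - 3/2| ≤ 9/2, which is the stated window. -/
lemma canonicalPairing_eq {u t : ℝ} (h1 : u - 6 ≤ 3 * t) (h2 : 3 * t ≤ u + 3) :
    canonicalPairing u t = u * t := by
  refine le_antisymm (ciSup_le fun j => ?_) ?_
  · rw [deckAct_eq]
    have : (j : ℝ) * (u - 3 * t - 3 / 2) ≤ 9 / 2 * (j : ℝ) ^ 2 := by
      rcases lt_trichotomy j 0 with hj | rfl | hj
      · have : (j : ℝ) ≤ -1 := by exact_mod_cast Int.le_sub_one_of_lt hj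
        nlinarith
      · simp
      · have : (1 : ℝ) ≤ j := by exact_mod_cast hj
        nlinarith
    nlinarith
  · refine le_trans (le_of_eq ?_) (le_ciSup (bddAbove_deckAct u t) 0)
    rw [deckAct_eq]
    simp

lemma convexSection_of_mem {t : ℝ} (k : ℤ) (h1 : (k : ℝ) ≤ t) (h2 : t ≤ k + 1) :
    convexSection t = 3 * (k + 1) * t - 1 - 3 * k * (k + 1) / 2 := by
  rw [convexSection_eq]
  rcases h2.lt_or_eq with h | rfl
  · rw [Int.floor_eq_iff.2 ⟨h1, h⟩]
  · have : ⌊(k : ℝ) + 1⌋ = k + 1 := by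
      rw [Int.floor_eq_iff]
      push_cast
      constructor <;> linarith
    rw [this]
    push_cast
    ring

lemma nCover_of_mem {t : ℝ} (k : ℤ) (h1 : (k : ℝ) ≤ t) (h2 : t ≤ k + 1) :
    nCover t = ((k : ℝ) + 1 - t) • nVert (res k) + (t - k) • nVert (res k + 1) := by
  rw [nCover, nEdge, res_succ]
  rcases h2.lt_or_eq with h | rfl
  · rw [Int.floor_eq_iff.2 ⟨h1, h⟩]
  · have : ⌊(k : ℝ) + 1⌋ = k + 1 := by
      rw [Int.floor_eq_iff]
      push_cast
      constructor <;> linarith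
    rw [this, res_succ]
    push_cast
    simp

/-- Φ₀ has slope 0 on [-1,0] and 3 on [0,1], so for such u the convex function Φ₀(t) - ut is minimal
at t = 0, with value -1. -/
lemma mul_sub_convexSection_le {u : ℝ} (h0 : 0 ≤ u) (h3 : u ≤ 3) (t : ℝ) :
    u * t - convexSection t ≤ 1 := by
  rw [convexSection_eq]
  have h1 := Int.floor_le t
  have h2 := Int.lt_floor_add_one t
  rcases lt_or_ge ⌊t⌋ 0 with h | h
  · have h' : (0 : ℝ) ≤ (⌊t⌋ + 1) * (⌊t⌋ + 2) := by
      have : (0 : ℤ) ≤ (⌊t⌋ + 1) * (⌊t⌋ + 2) := by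
        rcases (Int.le_sub_one_of_lt h).eq_or_lt with h | h
        · rw [h]; norm_num
        · exact mul_nonneg_of_nonpos_of_nonpos (by omega) (by omega)
      exact_mod_cast this
    have h'' : (⌊t⌋ : ℝ) + 1 ≤ 0 := by exact_mod_cast h
    have e1 : (3 * (⌊t⌋ + 1) - u) * (⌊t⌋ + 1) ≤ (3 * (⌊t⌋ + 1) - u) * t :=
      mul_le_mul_of_nonpos_left h2.le (by linarith)
    have e2 : 0 ≤ -u * (⌊t⌋ + 1) := mul_nonneg_of_nonpos_of_nonpos (by linarith) h''
    linarith
  · have h' : (0 : ℝ) ≤ ⌊t⌋ * (⌊t⌋ - 1) := by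
      have : (0 : ℤ) ≤ ⌊t⌋ * (⌊t⌋ - 1) := by
        rcases h.eq_or_lt with h | h
        · rw [← h]; norm_num
        · exact mul_nonneg (by omega) (by omega)
      exact_mod_cast this
    have h'' : (0 : ℝ) ≤ ⌊t⌋ := by exact_mod_cast h
    have e1 : (3 * (⌊t⌋ + 1) - u) * ⌊t⌋ ≤ (3 * (⌊t⌋ + 1) - u) * t :=
      mul_le_mul_of_nonneg_left h1 (by linarith)
    have e2 : 0 ≤ (3 - u) * ⌊t⌋ := mul_nonneg (by linarith) h''
    linarith

/-- Φ₀ is a global section, hence compatible with the monodromy. Thus the supremum over Γ is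
absorbed in the supremum over t, and `legendre` reduces to the ordinary transform of Φ₀. -/
lemma deckAct_sub_convexSection (j : ℤ) (u t : ℝ) : deckAct j u 0 t - convexSection t =
    u * (t + (3 * j : ℤ)) - convexSection (t + (3 * j : ℤ)) := by
  rw [deckAct_eq, convexSection_eq, convexSection_eq, Int.floor_add_intCast]
  push_cast
  ring

lemma legendre_eq {u : ℝ} (h0 : 0 ≤ u) (h3 : u ≤ 3) : legendre u = 1 := by
  refine le_antisymm (ciSup_le fun t => ?_) ?_
  · have : canonicalPairing u t ≤ 1 + convexSection t := ciSup_le fun j => by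
      have e := deckAct_sub_convexSection j u t
      have := mul_sub_convexSection_le h0 h3 (t + (3 * j : ℤ))
      linarith
    linarith
  · refine le_trans (le_of_eq ?_) (le_ciSup (bddAbove_legendre u) 0)
    rw [canonicalPairing_eq (by linarith) (by linarith),
      convexSection_of_mem 0 (by simp) (by simp)]
    simp

/-- The integer k selects the lift k + r of the point n; any lift inside the window of
`canonicalPairing_eq` will do. -/
lemma cost_eq {u : ℝ} (h0 : 0 ≤ u) (h3 : u < 3) {r : ℝ} (hr : r ∈ Set.Icc (0 : ℝ) 1) (k : ℤ)
    (h1 : u - 6 ≤ 3 * (k + r)) (h2 : 3 * (k + r) ≤ u + 3) :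
    cost ((1 - r) • nVert (res k) + r • nVert (res k + 1))
      ((1 - u / 3) • mVert 0 + (u / 3) • mVert 1) =
      (3 * (k + 1) - u) * (k + r) - 3 * k * (k + 1) / 2 := by
  have hk1 : (k : ℝ) ≤ k + r := by linarith [hr.1]
  have hk2 : (k : ℝ) + r ≤ k + 1 := by linarith [hr.2]
  have e1 : (1 - r) • nVert (res k) + r • nVert (res k + 1) = nCover (k + r) := by
    rw [nCover_of_mem k hk1 hk2]
    congr 2 <;> ring
  have e2 : (1 - u / 3) • mVert 0 + (u / 3) • mVert 1 = mCover u := by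
    have : ⌊u / 3⌋ = 0 := Int.floor_eq_iff.2 ⟨by simpa using by positivity, by
      norm_num
      linarith⟩
    rw [mCover, this, show res 0 = 0 from rfl, show res (0 + 1) = 1 from rfl]
    simp
  rw [e1, e2, cost_cover, coverCost, canonicalPairing_eq h1 h2, convexSection_of_mem k hk1 hk2,
    legendre_eq h0 h3.le]
  ring

end

end FermatCubic

/-! ### Comparison of valuation and cost -/

theorem mainTheorem5 (a b : ℕ) (hb : 1 ≤ b) (hab : b < a)
    (i : Fin 3) (r : ℝ) (hr : r ∈ Set.Icc (0 : ℝ) 1) :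
    FermatCubic.val i r (FermatCubic.S a b) =
      ((((a : ℝ) + b) / 3 * FermatCubic.cost
        ((1 - r) • FermatCubic.nVert i + r • FermatCubic.nVert (i + 1))
        (((a : ℝ) / ((a : ℝ) + b)) • FermatCubic.mVert 0 +
          ((b : ℝ) / ((a : ℝ) + b)) • FermatCubic.mVert 1) : ℝ) : EReal) := by
  have hb' : (1 : ℝ) ≤ b := by exact_mod_cast hb
  have hab' : (b : ℝ) < a := by exact_mod_cast hab
  have hpos : (0 : ℝ) < a + b := by linarith
  -- The coordinate of the given point of the edge from m₀ to m₁ on the universal cover of ∂Δ.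
  obtain ⟨u, hu⟩ : ∃ u : ℝ, u = 3 * b / (a + b) := ⟨_, rfl⟩
  have hub : u * (a + b) = 3 * b := by
    rw [hu, div_mul_cancel₀ _ hpos.ne']
  have hu0 : 0 ≤ u := by
    rw [hu]
    positivity
  have hu3 : u < 3 := by
    rw [hu, div_lt_iff₀ hpos]
    linarith
  have e0 : (a : ℝ) / (a + b) = 1 - u / 3 := by
    rw [hu]
    field_simp
    ring
  have e1 : (b : ℝ) / (a + b) = u / 3 := by
    rw [hu]
    field_simp
  rw [e0, e1]
  have hS := FermatCubic.newtonShape_S a b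
  have hr0 := hr.1
  have hr1 := hr.2
  have hi : i = 0 ∨ i = 1 ∨ i = 2 := by
    revert i
    decide
  rcases hi with rfl | rfl | rfl
  · have hc := FermatCubic.cost_eq hu0 hu3 hr 0 (by push_cast; linarith) (by push_cast; linarith)
    rw [show FermatCubic.res 0 = 0 from rfl] at hc
    rw [FermatCubic.val, hS.lead_zero.weightVal hr, hc]
    congr 1
    push_cast
    linear_combination (r / 3) * hub
  · rw [hS.val_one (by omega) (by omega) hr]
    -- The lift 1 + r lies in the window exactly when 3r ≤ u, and -2 + r exactly when 3r ≥ u. The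
    -- kink 3r = u is where the two corners of the Newton polygon have equal weight.
    rcases le_total (3 * r) u with h | h
    · have hc := FermatCubic.cost_eq hu0 hu3 hr 1 (by push_cast; linarith) (by push_cast; linarith)
      rw [show FermatCubic.res 1 = 1 from rfl] at hc
      rw [hc, min_eq_left (by nlinarith [mul_le_mul_of_nonneg_right h hpos.le])]
      congr 1
      push_cast
      linear_combination ((1 + r) / 3) * hub
    · have hc := FermatCubic.cost_eq hu0 hu3 hr (-2) (by push_cast; linarith)
        (by push_cast; linarith)
      rw [show FermatCubic.res (-2) = 1 from rfl] at hc
      rw [hc, min_eq_right (by nlinarith [mul_le_mul_of_nonneg_right h hpos.le])]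
      congr 1
      push_cast
      linear_combination ((r - 2) / 3) * hub
  · have hc := FermatCubic.cost_eq hu0 hu3 hr (-1) (by push_cast; linarith)
      (by push_cast; linarith)
    rw [show FermatCubic.res (-1) = 2 from rfl] at hc
    rw [FermatCubic.val, hS.lead_two.weightVal hr, hc]
    congr 1
    push_cast
    linear_combination ((r - 1) / 3) * hub
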